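/- Let $p,q,a,b,\mu\in\mathbb R$ with $b\neq 0$, $p^2+q^2\neq 0$ and $0<\mu<1$. All functions are real valued. For $s>0$, let $n$ be the smallest integer greater than $s$, and for $\psi\in C_0^\infty(\mathbb R)$ let \[ \boldsymbol D^{s}\psi(x)=\frac{d^n}{dx^n}\,\frac1{\Gamma(n-s)}\int_{-\infty}^x (x-t)^{n-s-1}\psi(t)\,dt,\qquad \boldsymbol D^{s*}\psi(x)=(-1)^n\frac{d^n}{dx^n}\,\frac1{\Gamma(n-s)}\int_x^{\infty} (t-x)^{n-s-1}\psi(t)\,dt \] be the left and right Riemann--Liouville derivatives. For $v,w\in L^1_{loc}(\mathbb R)$, $w$ is the weak left (right) derivative $\boldsymbol D^{s}v$ ($\boldsymbol D^{s*}v$) if for every $\psi\in C_0^\infty(\mathbb R)$ the function $v\,\boldsymbol D^{s*}\psi$ (respectively $v\,\boldsymbol D^{s}\psi$) is integrable and $\int v\,\boldsymbol D^{s*}\psi=\int w\psi$ (respectively $\int v\,\boldsymbol D^{s}\psi=\int w\psi$); $Dv$ is the usual weak derivative. For $s\ge 0$ let \[ \widehat H^s(\mathbb R)=\Big\{w\in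 L^2(\mathbb R):\int_{\mathbb R}(1+|2\pi\xi|^{2s})|\widehat w(\xi)|^2\,d\xi<\infty\Big\},\qquad \|w\|_{\widehat H^s}=\Big(\|w\|_{L^2}^2+\int_{\mathbb R}|2\pi\xi|^{2s}|\widehat w(\xi)|^2\,d\xi\Big)^{1/2}, \] where $\widehat w$ is the Fourier--Plancherel transform with kernel $e^{-2\pi i x\xi}$. Put $Lu=p\boldsymbol D^{2-\mu}u+q\boldsymbol D^{(2-\mu)*}u+aDu+bu$, all derivatives being weak; a solution of $Lu=f$, where $f\in L^2(\mathbb R)$, is a $u\in\widehat H^{2-\mu}(\mathbb R)$ whose three weak derivatives exist and which satisfies the equation almost everywhere. Let \[ \sigma_1=2-\mu,\quad \sigma_2=\tfrac{3-\mu}2,\quad \sigma_3=1,\quad \sigma_4=\tfrac{2-\mu}2,\quad \sigma_5=0, \] \[ C_1=p^2+q^2+2pq\cos(\sigma_1\pi),\quad C_2=2a(q-p)\cos(\sigma_2\pi),\quad C_3=a^2,\quad C_4=2b(p+q)\cos(\sigma_4\pi),\quad C_5=b^2, \] and assume that one of the following holds: (i) $C_2\ge0$, $C_4\ge 0$; (ii)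 $C_2\ge 0$, $C_4<0$, and there is $\alpha>0$ with $\sum_{j=1}^4 C_j\alpha^{1-2\sigma_j}>0$ and $b^2>-C_4\alpha^{2(\sigma_5-\sigma_4)}$; (iii) $C_2<0$, $C_4\ge0$, and there is $\alpha>0$ with $\sum_{j=1}^2 C_j\alpha^{1-2\sigma_j}>0$ and $b^2>-\sum_{j=2}^4C_j\alpha^{2(\sigma_5-\sigma_j)}$; (iv) $C_2<0$, $C_4<0$, and there is $\alpha>0$ with $\sum_{j=1,2,4} C_j\alpha^{1-2\sigma_j}>0$ and $b^2>-\sum_{j=2,4}C_j\alpha^{2(\sigma_5-\sigma_j)}$. Then there is a constant $C>0$, depending only on $L$ (that is, on $p,q,a,b,\mu$), such that for every integer $m\ge 0$ and every $f\in\widehat H^m(\mathbb R)$ the equation $Lu=f$ has a unique solution $u\in \widehat H^{2-\mu}(\mathbb R)$, this solution belongs to $\widehat H^{2-\mu+m}(\mathbb R)$, and \[ \|u\|_{\widehat H^{2-\mu+m}(\mathbb R)}\le C\|f\|_{\widehat H^m(\mathbb R)}. \] -/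

import Mathlib

open MeasureTheory Set
open scoped FourierTransform ContDiff

noncomputable section

/-- The space of real-valued square integrable functions on the line (modulo a.e. equality). -/
abbrev L2R : Type := Lp ℝ 2 (volume : Measure ℝ)

/-! ### Riemann-Liouville integrals and derivatives on the whole line -/

/-- Left Riemann-Liouville integral of order `σ > 0`. -/
def rlIntegral (σ : ℝ) (w : ℝ → ℝ) (x : ℝ) : ℝ :=
  1 / Real.Gamma σ * ∫ s in Iio x, (x - s) ^ (σ - 1) * w s

/-- Right Riemann-Liouville integral of order `σ > 0`. -/
def rlIntegralStar (σ : ℝ) (w : ℝ → ℝ) (x : ℝ) : ℝ :=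
  1 / Real.Gamma σ * ∫ s in Ioi x, (s - x) ^ (σ - 1) * w s

/-- Left Riemann-Liouville derivative of order `s > 0`: with `n = ⌊s⌋ + 1` the smallest integer
greater than `s`, the `n`-th derivative of the left integral of order `n - s`. -/
def rlDeriv (s : ℝ) (w : ℝ → ℝ) : ℝ → ℝ :=
  iteratedDeriv (⌊s⌋₊ + 1) (rlIntegral (((⌊s⌋₊ + 1 : ℕ) : ℝ) - s) w)

/-- Right Riemann-Liouville derivative of order `s > 0`, with the sign `(-1) ^ n`. -/
def rlDerivStar (s : ℝ) (w : ℝ → ℝ) (x : ℝ) : ℝ :=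
  (-1) ^ (⌊s⌋₊ + 1) *
    iteratedDeriv (⌊s⌋₊ + 1) (rlIntegralStar (((⌊s⌋₊ + 1 : ℕ) : ℝ) - s) w) x

/-! ### Weak derivatives -/

/-- Membership in the space of smooth functions with compact support. -/
def IsTestFn (ψ : ℝ → ℝ) : Prop := ContDiff ℝ ∞ ψ ∧ HasCompactSupport ψ

/-- `w` is the weak left fractional derivative of order `s` of `v`. Integrability of the product
on the left is required, so that the pairing has a meaning; the product on the right is always
integrable. -/
def IsWeakFracDeriv (s : ℝ) (v w : ℝ → ℝ) : Prop :=
  LocallyIntegrable v ∧ LocallyIntegrable w ∧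
    ∀ ψ : ℝ → ℝ, IsTestFn ψ →
      Integrable (fun x => v x * rlDerivStar s ψ x) ∧
        ∫ x, v x * rlDerivStar s ψ x = ∫ x, w x * ψ x

/-- `w` is the weak right fractional derivative of order `s` of `v`. -/
def IsWeakFracDerivStar (s : ℝ) (v w : ℝ → ℝ) : Prop :=
  LocallyIntegrable v ∧ LocallyIntegrable w ∧
    ∀ ψ : ℝ → ℝ, IsTestFn ψ →
      Integrable (fun x => v x * rlDeriv s ψ x) ∧
        ∫ x, v x * rlDeriv s ψ x = ∫ x, w x * ψ x

/-- `w` is the (ordinary, first order) weak derivative of `v`. -/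
def IsWeakDeriv (v w : ℝ → ℝ) : Prop :=
  LocallyIntegrable v ∧ LocallyIntegrable w ∧
    ∀ ψ : ℝ → ℝ, IsTestFn ψ → ∫ x, v x * deriv ψ x = -∫ x, w x * ψ x

/-! ### Sobolev spaces through the Fourier transform -/

/-- The Plancherel transform of a real-valued square integrable function, for the kernel
`exp (-2πi x ξ)`. -/
def plancherel (w : L2R) : Lp ℂ 2 (volume : Measure ℝ) :=
  𝓕 (Complex.ofRealCLM.compLp w)

/-- `w` belongs to the Sobolev space of order `s ≥ 0`. -/
def MemHhat (s : ℝ) (w : L2R) : Prop :=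
  Integrable fun ξ : ℝ => (1 + |2 * Real.pi * ξ| ^ (2 * s)) * ‖plancherel w ξ‖ ^ 2

/-- The Sobolev seminorm: the `L²` norm of `(2πξ)^s ŵ(ξ)`. -/
def seminormHhat (s : ℝ) (w : L2R) : ℝ :=
  Real.sqrt (∫ ξ : ℝ, (|2 * Real.pi * ξ| ^ s * ‖plancherel w ξ‖) ^ 2)

/-- The Sobolev norm. -/
def normHhat (s : ℝ) (w : L2R) : ℝ :=
  Real.sqrt (‖w‖ ^ 2 + seminormHhat s w ^ 2)

/-! ### The equation -/

/-- `u` is a (strong) solution in the Sobolev space of order `2 - μ` of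
`p D^{2-μ} u + q D^{(2-μ)*} u + a D u + b u = f`, all derivatives being weak ones. -/
def IsSolution (p q a b μ : ℝ) (f u : L2R) : Prop :=
  MemHhat (2 - μ) u ∧
    ∃ v₁ v₂ v₃ : ℝ → ℝ,
      IsWeakFracDeriv (2 - μ) u v₁ ∧ IsWeakFracDerivStar (2 - μ) u v₂ ∧ IsWeakDeriv u v₃ ∧
        ∀ᵐ x : ℝ, p * v₁ x + q * v₂ x + a * v₃ x + b * u x = f x

/-- The exponents `σ₁, …, σ₅` (the value at other indices is never used). -/
def sigmaExp (μ : ℝ) : ℕ → ℝ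
  | 1 => 2 - μ
  | 2 => (3 - μ) / 2
  | 3 => 1
  | 4 => (2 - μ) / 2
  | _ => 0

/-- The coefficients `C₁, …, C₅` (the value at other indices is never used). -/
def coefC (p q a b μ : ℝ) : ℕ → ℝ
  | 1 => p ^ 2 + q ^ 2 + 2 * p * q * Real.cos (sigmaExp μ 1 * Real.pi)
  | 2 => 2 * a * (q - p) * Real.cos (sigmaExp μ 2 * Real.pi)
  | 3 => a ^ 2
  | 4 => 2 * b * (p + q) * Real.cos (sigmaExp μ 4 * Real.pi)
  | 5 => b ^ 2
  | _ => 0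

/-- The four alternative conditions on the coefficients of the equation. -/
def CoefCondition (p q a b μ : ℝ) : Prop :=
  let C := coefC p q a b μ
  let σ := sigmaExp μ
  (0 ≤ C 2 ∧ 0 ≤ C 4) ∨
  (0 ≤ C 2 ∧ C 4 < 0 ∧ ∃ α : ℝ, 0 < α ∧
    0 < ∑ j ∈ ({1, 2, 3, 4} : Finset ℕ), C j / α ^ (2 * σ j - 1) ∧
    b ^ 2 > -C 4 * α ^ (2 * (σ 5 - σ 4))) ∨
  (C 2 < 0 ∧ 0 ≤ C 4 ∧ ∃ α : ℝ, 0 < α ∧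
    0 < ∑ j ∈ ({1, 2} : Finset ℕ), C j / α ^ (2 * σ j - 1) ∧
    b ^ 2 > -∑ j ∈ ({2, 3, 4} : Finset ℕ), C j * α ^ (2 * (σ 5 - σ j))) ∨
  (C 2 < 0 ∧ C 4 < 0 ∧ ∃ α : ℝ, 0 < α ∧
    0 < ∑ j ∈ ({1, 2, 4} : Finset ℕ), C j / α ^ (2 * σ j - 1) ∧
    b ^ 2 > -∑ j ∈ ({2, 4} : Finset ℕ), C j * α ^ (2 * (σ 5 - σ j)))

end

/-!
On the Fourier side, with `ω = 2πξ` and `s = 2 - μ`, the operator `L` is multiplication by `P ξ =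
p (iω)^s + q (-iω)^s + a iω + b` (`opSymbol`), and `|P ξ|² = C₁|ω|^(2σ₁) + ⋯ + C₅|ω|^(2σ₅)`
(`sq_norm_opSymbol`). Each of the four conditions makes this sum positive (`sum_coefC_rpow_pos`):
at `|ω| = 1/α` the hypotheses say that a group of leading terms and a group of trailing terms are
both positive, and a comparison of powers carries the first to `|ω| ≥ 1/α` and the second to `|ω|
≤ 1/α`. Since `C₁ > 0`, compactness gives `|P ξ|² ≥ c (1 + |ω|^(2s))`
(`exists_le_sq_norm_opSymbol`). Hence `û = f̂ / P` defines the solution and it gains `s`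
derivatives, with a constant independent of `m` (`memHhat_add_and_normHhat_le`); `u` is real
because `P` and `f̂` are Hermitian (`exists_plancherel_eq`).

What links this to the weak fractional derivatives is that the Riemann-Liouville derivatives of a
test function `ψ` are the inverse Fourier integrals of `(±iω)^s ψ̂` (`rlDeriv_eq_fourierInv`,
`rlDerivStar_eq_fourierInv`). The two outer derivatives fall on `ψ`, so this reduces to a fractional
integral of order `2 - s`. Its kernel is not integrable; damping it by `exp (-εt)` gives an
integrable kernel with transform `(ε + iω)^(s - 2)`, and `ε → 0` is a dominated limit on both
sides (`rlIntegral_eq_fourierInv`). Parseval's formula then shows that the functions with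
transforms `(±iω)^s û` are the weak derivatives of `u` (`integral_mul_eq_of_multiplier`), and weak
derivatives are unique, so that being a solution is equivalent to `P û = f̂`
(`isSolution_iff_plancherel`).
-/

open Filter Topology Complex

/-! ### The fractional integral as a Fourier multiplier -/

/-- The Laplace transform of `t ^ (a - 1)` on the right half-plane: both sides are analytic in `r`
and agree for real `r > 0`. -/
lemma integral_rpow_mul_cexp_neg_mul_Ioi {a : ℝ} (ha : 0 < a) {r : ℂ} (hr : 0 < r.re) :
    ∫ t in Ioi (0 : ℝ), ((t ^ (a - 1) : ℝ) : ℂ) * cexp (-(r * t)) =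
      Real.Gamma a * r ^ (-a : ℂ) := by
  -- The left-hand side is the moment generating function at `-r` of the measure `t ^ (a - 1) dt`,
  -- whose analyticity is known.
  set ν : Measure ℝ :=
    (volume.restrict (Ioi (0 : ℝ))).withDensity fun t => ENNReal.ofReal (t ^ (a - 1)) with hν
  have hmeas : Measurable fun t : ℝ => ENNReal.ofReal (t ^ (a - 1)) := by fun_prop
  have hlt : ∀ᵐ t ∂(volume.restrict (Ioi (0 : ℝ))), ENNReal.ofReal (t ^ (a - 1)) < ⊤ := by simp
  have hpos : ∀ᵐ t ∂(volume.restrict (Ioi (0 : ℝ))), 0 < t :=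
    ae_restrict_mem measurableSet_Ioi
  have hF (z : ℂ) : ProbabilityTheory.complexMGF id ν z =
      ∫ t in Ioi (0 : ℝ), ((t ^ (a - 1) : ℝ) : ℂ) * cexp (z * t) := by
    rw [ProbabilityTheory.complexMGF, hν, integral_withDensity_eq_integral_toReal_smul hmeas hlt]
    refine integral_congr_ae ?_
    filter_upwards [hpos] with t ht
    rw [ENNReal.toReal_ofReal (by positivity)]
    simp
  have hset : Iio (0 : ℝ) ⊆ interior (ProbabilityTheory.integrableExpSet id ν) := by
    refine interior_maximal (fun x hx => ?_) isOpen_Iio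
    simp only [ProbabilityTheory.integrableExpSet, mem_ofPred_eq, id, hν]
    rw [integrable_withDensity_iff_integrable_smul₀' hmeas.aemeasurable hlt]
    have := integrableOn_rpow_mul_exp_neg_mul_rpow (p := 1) (s := a - 1) (b := -x) (by linarith)
      one_pos (by simpa using hx)
    refine (this.congr_fun_ae ?_)
    filter_upwards [hpos] with t ht
    rw [ENNReal.toReal_ofReal (by positivity)]
    simp
  have hA : AnalyticOnNhd ℂ (ProbabilityTheory.complexMGF id ν) {z | z.re < 0} :=
    ProbabilityTheory.analyticOnNhd_complexMGF.mono fun z hz => hset hz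
  have hB : AnalyticOnNhd ℂ (fun z : ℂ => (Real.Gamma a : ℂ) * (-z) ^ (-a : ℂ)) {z | z.re < 0} := by
    refine DifferentiableOn.analyticOnNhd ?_ (isOpen_lt continuous_re continuous_const)
    intro z hz
    have : -z ∈ slitPlane := Or.inl (by simpa using hz)
    exact ((differentiableAt_id.neg.cpow (differentiableAt_const _) this).const_mul
      _).differentiableWithinAt
  have hreal : ∀ x : ℝ, x < 0 → ProbabilityTheory.complexMGF id ν x =
      (Real.Gamma a : ℂ) * (-(x : ℂ)) ^ (-a : ℂ) := by
    intro x hx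
    have h := integral_cpow_mul_exp_neg_mul_Ioi (a := a) (r := -x) (by simpa) (by linarith)
    rw [hF]
    have e : ((-x : ℝ) : ℂ) = -(x : ℂ) := by simp
    have hx' : (-(x : ℂ)).arg ≠ Real.pi := by
      rw [← e, arg_ofReal_of_nonneg (by linarith)]; exact Real.pi_pos.ne
    rw [e, one_div, inv_cpow _ _ hx', ← cpow_neg, mul_comm, Gamma_ofReal] at h
    rw [← h]
    refine setIntegral_congr_fun measurableSet_Ioi fun t ht => ?_
    have ht : (0 : ℝ) ≤ t := (mem_Ioi.1 ht).le
    simp only [ofReal_cpow ht]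
    push_cast
    ring_nf
  have hpre : IsPreconnected {z : ℂ | z.re < 0} := (convex_halfSpace_re_lt 0).isPreconnected
  have hfreq : ∃ᶠ z in 𝓝[≠] (-1 : ℂ), ProbabilityTheory.complexMGF id ν z =
      (Real.Gamma a : ℂ) * (-z) ^ (-a : ℂ) := by
    have ht : Tendsto (fun x : ℝ => (x : ℂ)) (𝓝[≠] (-1)) (𝓝[≠] (-1 : ℂ)) := by
      refine tendsto_nhdsWithin_iff.2 ⟨?_, ?_⟩
      · have := (continuous_ofReal.tendsto (-1 : ℝ)).mono_left
          (nhdsWithin_le_nhds (s := {(-1 : ℝ)}ᶜ))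
        simpa using this
      · filter_upwards [self_mem_nhdsWithin] with x hx
        simp only [mem_compl_iff, mem_singleton_iff] at hx ⊢
        exact fun h => hx (by exact_mod_cast h)
    refine ht.frequently (Eventually.frequently ?_)
    filter_upwards [nhdsWithin_le_nhds (Iio_mem_nhds (show (-1 : ℝ) < 0 by norm_num))] with x hx
    exact hreal x hx
  have key := hA.eqOn_of_preconnected_of_frequently_eq hB hpre
    (show (-1 : ℂ) ∈ {z : ℂ | z.re < 0} by simp) hfreq
  have := key (show -r ∈ {z : ℂ | z.re < 0} by simpa using hr)
  rw [hF] at this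
  simpa using this

/-- The symbol `(2πiξ) ^ s` of the left fractional derivative of order `s`, with the principal
branch of the power. -/
noncomputable def fracSymbol (s ξ : ℝ) : ℂ := (2 * Real.pi * ξ * I) ^ (s : ℂ)

lemma norm_fracSymbol (s ξ : ℝ) : ‖fracSymbol s ξ‖ = |2 * Real.pi * ξ| ^ s := by
  rw [fracSymbol, norm_cpow_real]
  congr 1
  simp [abs_of_pos Real.pi_pos, abs_mul]

lemma measurable_fracSymbol (s : ℝ) : Measurable (fracSymbol s) := by
  unfold fracSymbol; fun_prop

lemma fracSymbol_neg (s ξ : ℝ) : fracSymbol s (-ξ) = (starRingEnd ℂ) (fracSymbol s ξ) := by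
  have h : (2 * Real.pi * ξ * I : ℂ).arg ≠ Real.pi := by
    intro h
    rw [arg_eq_pi_iff] at h
    simp at h
  have := conj_cpow _ (s : ℂ) h
  rw [conj_ofReal] at this
  rw [fracSymbol, fracSymbol, ← this]
  congr 1
  simp [map_ofNat]

lemma fracSymbol_mul_sq {s ξ : ℝ} (hs : s ≠ 0) (hs2 : s + 2 ≠ 0) :
    fracSymbol s ξ * (2 * Real.pi * I * ξ) ^ 2 = fracSymbol (s + 2) ξ := by
  by_cases hξ : ξ = 0
  · subst hξ
    simp only [fracSymbol]
    have : ((s : ℂ) + 2) ≠ 0 := by exact_mod_cast hs2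
    simp [hs, this]
  · have h0 : (2 * Real.pi * ξ * I : ℂ) ≠ 0 := by
      simp [hξ, Real.pi_ne_zero, I_ne_zero]
    rw [fracSymbol, fracSymbol]
    push_cast
    rw [cpow_add _ _ h0]
    congr 1
    have : ((2 : ℂ)) = ((2 : ℕ) : ℂ) := by norm_num
    conv_rhs => rw [this, cpow_natCast]
    push_cast
    ring

/-- The Fourier transform of the exponentially damped kernel of the fractional integral. -/
lemma fourier_damped_kernel {σ ε : ℝ} (hσ : 0 < σ) (hε : 0 < ε) (ξ : ℝ) :
    𝓕 ((Ioi (0 : ℝ)).indicator fun t : ℝ => ((t ^ (σ - 1) : ℝ) : ℂ) * cexp (-(ε * t))) ξ =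
      Real.Gamma σ * (ε + 2 * Real.pi * ξ * I) ^ (-σ : ℂ) := by
  rw [← integral_rpow_mul_cexp_neg_mul_Ioi hσ (r := ε + 2 * Real.pi * ξ * I) (by simpa),
    Real.fourier_real_eq_integral_exp_smul, ← integral_indicator measurableSet_Ioi]
  congr 1
  ext t
  by_cases ht : t ∈ Ioi (0 : ℝ)
  · simp only [indicator_of_mem ht, smul_eq_mul]
    rw [mul_left_comm, ← Complex.exp_add]
    congr 2
    push_cast
    ring
  · simp [indicator_of_notMem ht]

lemma integrable_damped_kernel {σ ε : ℝ} (hσ : 0 < σ) (hε : 0 < ε) :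
    Integrable ((Ioi (0 : ℝ)).indicator
      fun t : ℝ => ((t ^ (σ - 1) : ℝ) : ℂ) * cexp (-(ε * t))) := by
  rw [integrable_indicator_iff measurableSet_Ioi]
  have := (integrableOn_rpow_mul_exp_neg_mul_rpow (p := 1) (s := σ - 1) (b := ε) (by linarith)
      one_pos hε).ofReal (𝕜 := ℂ)
  refine this.congr (Eventually.of_forall fun t => ?_)
  simp

/-- The kernel `t₊ ^ (σ - 1)` of the left fractional integral, without its Gamma factor. -/
noncomputable def rlKernel (σ : ℝ) : ℝ → ℝ := (Ioi (0 : ℝ)).indicator fun t => t ^ (σ - 1)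

lemma locallyIntegrable_rlKernel {σ : ℝ} (hσ : 0 < σ) : LocallyIntegrable (rlKernel σ) := by
  rw [locallyIntegrable_iff]
  intro K hK
  obtain ⟨R, hR⟩ := hK.isBounded.subset_closedBall 0
  have h1 : IntegrableOn (fun t : ℝ => t ^ (σ - 1)) (Ioc 0 R) :=
    (intervalIntegral.intervalIntegrable_rpow' (a := 0) (b := R) (by linarith)).1
  have h2 : IntegrableOn (rlKernel σ) (Ioc 0 R) := by
    refine h1.congr_fun (fun t ht => ?_) measurableSet_Ioc
    rw [rlKernel, indicator_of_mem (show t ∈ Ioi (0 : ℝ) from ht.1)]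
  have h3 : IntegrableOn (rlKernel σ) (Iic 0) := by
    refine (integrableOn_zero (ε' := ℝ)).congr_fun (fun t ht => ?_) measurableSet_Iic
    have ht' : t ∉ Ioi (0 : ℝ) := fun h => absurd (mem_Ioi.1 h) (not_lt.2 ht)
    simp [rlKernel, indicator_of_notMem ht']
  refine (h3.union h2).mono_set fun t ht => ?_
  have : |t| ≤ R := by simpa using hR ht
  by_cases h : t ≤ 0
  · exact Or.inl h
  · exact Or.inr ⟨not_le.1 h, (le_abs_self t).trans this⟩

lemma rlIntegral_eq_convolution (σ : ℝ) (w : ℝ → ℝ) :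
    rlIntegral σ w = fun x => 1 / Real.Gamma σ *
      MeasureTheory.convolution (rlKernel σ) w (ContinuousLinearMap.mul ℝ ℝ) volume x := by
  ext x
  rw [rlIntegral, MeasureTheory.convolution_def]
  congr 1
  rw [← integral_indicator measurableSet_Iio, ← integral_sub_left_eq_self _ _ x]
  congr 1
  ext t
  by_cases ht : 0 < t
  · simp [rlKernel, ht]
  · simp [rlKernel, ht]

lemma hasDerivAt_rlIntegral {σ : ℝ} (hσ : 0 < σ) {w : ℝ → ℝ} (hw : ContDiff ℝ 1 w)
    (hc : HasCompactSupport w) (x : ℝ) :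
    HasDerivAt (rlIntegral σ w) (rlIntegral σ (deriv w) x) x := by
  simp only [rlIntegral_eq_convolution]
  exact (hc.hasDerivAt_convolution_right _ (locallyIntegrable_rlKernel hσ) hw x).const_mul _

/-- Parseval's formula for the convolution of a function with the damped kernel. -/
lemma integral_damped_kernel_mul {σ ε : ℝ} (hσ : 0 < σ) (hε : 0 < ε) {w : ℝ → ℂ}
    (hw : Continuous w) (hi : Integrable w) (hF : Integrable (𝓕 w)) (x : ℝ) :
    ∫ t, ((rlKernel σ t : ℝ) : ℂ) * cexp (-(ε * t)) * w (x - t) =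
      Real.Gamma σ * ∫ ξ : ℝ, (ε + 2 * Real.pi * ξ * I) ^ (-σ : ℂ) *
        (cexp (2 * Real.pi * ξ * x * I) * 𝓕 w ξ) := by
  set G : ℝ → ℂ := fun ξ => cexp (2 * Real.pi * ξ * x * I) * 𝓕 w ξ with hG
  have hGi : Integrable G := by
    refine hF.bdd_mul (c := 1) (by fun_prop) (Eventually.of_forall fun ξ => ?_)
    rw [← ofReal_ofNat, ← ofReal_mul, ← ofReal_mul, ← ofReal_mul, norm_exp_ofReal_mul_I]
  have hinv (t : ℝ) : w (x - t) = 𝓕 G t := by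
    conv_lhs => rw [← hw.fourierInv_fourier_eq hi hF]
    rw [Real.fourierInv_eq', Real.fourier_real_eq_integral_exp_smul]
    congr 1
    ext ξ
    rw [hG, smul_eq_mul, smul_eq_mul, ← mul_assoc, ← Complex.exp_add]
    congr 2
    simp
    ring
  have hflip := VectorFourier.integral_fourierIntegral_smul_eq_flip (L := innerₗ ℝ)
    (μ := volume) (ν := volume) Real.continuous_fourierChar continuous_inner
    (integrable_damped_kernel hσ hε) hGi
  have hflip' : ∫ ξ, 𝓕 ((Ioi (0 : ℝ)).indicator
      fun t : ℝ => ((t ^ (σ - 1) : ℝ) : ℂ) * cexp (-(ε * t))) ξ • G ξ =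
      ∫ t, (Ioi (0 : ℝ)).indicator
        (fun t : ℝ => ((t ^ (σ - 1) : ℝ) : ℂ) * cexp (-(ε * t))) t • 𝓕 G t := by
    simpa using! hflip
  simp only [fourier_damped_kernel hσ hε, smul_eq_mul] at hflip'
  rw [← integral_const_mul]
  refine Eq.trans ?_ (hflip'.symm.trans (integral_congr_ae (Eventually.of_forall fun ξ => ?_)))
  swap
  · simp only [hG, mul_assoc]
  congr 1
  ext t
  rw [hinv]
  congr 1
  by_cases ht : t ∈ Ioi (0 : ℝ)
  · simp [rlKernel, indicator_of_mem ht]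
  · simp [rlKernel, indicator_of_notMem ht]

/-- The left fractional integral acts on the Fourier side as multiplication by `(2πiξ) ^ (-σ)`:
Parseval's formula for the kernel damped by `exp (-ε t)`, in the limit `ε → 0`. -/
theorem rlIntegral_eq_fourierInv {σ : ℝ} (hσ : 0 < σ) {w : ℝ → ℝ} (hw : Continuous w)
    (hc : HasCompactSupport w) (hF : Integrable (𝓕 fun x => (w x : ℂ)))
    (hm : Integrable fun ξ => fracSymbol (-σ) ξ * 𝓕 (fun x => (w x : ℂ)) ξ) (x : ℝ) :
    (rlIntegral σ w x : ℂ) =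
      𝓕⁻ (fun ξ => fracSymbol (-σ) ξ * 𝓕 (fun x => (w x : ℂ)) ξ) x := by
  set W : ℝ → ℂ := fun x => (w x : ℂ) with hW
  have hWc : Continuous W := by fun_prop
  have hWi : Integrable W := (hw.integrable_of_hasCompactSupport hc).ofReal
  have hkw : Integrable fun t => ((rlKernel σ t : ℝ) : ℂ) * W (x - t) := by
    have := ((locallyIntegrable_rlKernel hσ).integrable_smul_right_of_hasCompactSupport
      (hw.comp (continuous_const.sub continuous_id))
      (hc.comp_homeomorph (Homeomorph.subLeft x))).ofReal (𝕜 := ℂ)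
    refine this.congr (Eventually.of_forall fun t => ?_)
    simp [hW]
  -- As `ε → 0`, the damped integrals are dominated by the undamped one, because `w` has compact
  -- support and the kernel is locally integrable.
  have hlim1 : Tendsto (fun ε : ℝ => ∫ t, ((rlKernel σ t : ℝ) : ℂ) * cexp (-(ε * t)) * W (x - t))
      (𝓝[>] 0) (𝓝 (∫ t, ((rlKernel σ t : ℝ) : ℂ) * W (x - t))) := by
    refine tendsto_integral_filter_of_dominated_convergence
      (fun t => ‖((rlKernel σ t : ℝ) : ℂ) * W (x - t)‖) ?_ ?_ hkw.norm ?_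
    · refine Eventually.of_forall fun ε => ?_
      have : AEStronglyMeasurable fun t : ℝ => cexp (-(ε * t)) :=
        (by fun_prop : Continuous fun t : ℝ => cexp (-(ε * t))).aestronglyMeasurable
      refine (this.mul hkw.aestronglyMeasurable).congr (Eventually.of_forall fun t => ?_)
      simp only [Pi.mul_apply]
      ring
    · filter_upwards [self_mem_nhdsWithin] with ε hε
      refine Eventually.of_forall fun t => ?_
      rw [mul_right_comm, norm_mul]
      by_cases ht : t ∈ Ioi (0 : ℝ)
      · refine mul_le_of_le_one_right (norm_nonneg _) ?_
        have : 0 ≤ ε * t := mul_nonneg (le_of_lt hε) (le_of_lt ht)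
        simpa [norm_exp] using this
      · simp [rlKernel, indicator_of_notMem ht]
    · refine Eventually.of_forall fun t => ?_
      have : Continuous fun ε : ℝ => ((rlKernel σ t : ℝ) : ℂ) * cexp (-(ε * t)) * W (x - t) := by
        fun_prop
      simpa using (this.tendsto 0).mono_left (nhdsWithin_le_nhds (s := Ioi 0))
  -- On the Fourier side `|ε + iω| ≥ |ω|` gives the integrable bound `|ω| ^ (-σ) |ŵ|`.
  have hlim2 : Tendsto (fun ε : ℝ => ∫ ξ : ℝ, (ε + 2 * Real.pi * ξ * I) ^ (-σ : ℂ) *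
        (cexp (2 * Real.pi * ξ * x * I) * 𝓕 W ξ))
      (𝓝[>] 0) (𝓝 (∫ ξ : ℝ, fracSymbol (-σ) ξ * (cexp (2 * Real.pi * ξ * x * I) * 𝓕 W ξ))) := by
    have hne : ∀ᵐ ξ : ℝ, ξ ≠ 0 := by simp [ae_iff]
    refine tendsto_integral_filter_of_dominated_convergence
      (fun ξ => ‖fracSymbol (-σ) ξ * 𝓕 W ξ‖) ?_ ?_ hm.norm ?_
    · refine Eventually.of_forall fun ε => ?_
      have h1 : Measurable fun ξ : ℝ => (ε + 2 * Real.pi * ξ * I) ^ (-σ : ℂ) := by fun_prop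
      have h2 : Measurable fun ξ : ℝ => cexp (2 * Real.pi * ξ * x * I) := by fun_prop
      exact h1.aestronglyMeasurable.mul (h2.aestronglyMeasurable.mul hF.aestronglyMeasurable)
    · filter_upwards [self_mem_nhdsWithin] with ε hε
      filter_upwards [hne] with ξ hξ
      have e1 : ‖cexp (2 * Real.pi * ξ * x * I)‖ = 1 := by
        rw [← ofReal_ofNat, ← ofReal_mul, ← ofReal_mul, ← ofReal_mul, norm_exp_ofReal_mul_I]
      rw [norm_mul, norm_mul, norm_mul, e1, one_mul]
      refine mul_le_mul_of_nonneg_right ?_ (norm_nonneg _)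
      rw [norm_fracSymbol, ← ofReal_neg, norm_cpow_real]
      refine Real.rpow_le_rpow_of_nonpos ?_ ?_ (by linarith)
      · simp [hξ, Real.pi_ne_zero]
      · have := abs_im_le_norm ((ε : ℂ) + 2 * Real.pi * ξ * I)
        simpa using this
    · filter_upwards [hne] with ξ hξ
      refine Tendsto.mul_const _ ?_
      have hsl : (2 * Real.pi * ξ * I : ℂ) ∈ slitPlane :=
        Or.inr (by simp [hξ, Real.pi_ne_zero])
      have h1 : Tendsto (fun ε : ℝ => (ε + 2 * Real.pi * ξ * I : ℂ)) (𝓝[>] 0)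
          (𝓝 (2 * Real.pi * ξ * I)) := by
        have : Continuous fun ε : ℝ => (ε + 2 * Real.pi * ξ * I : ℂ) := by fun_prop
        simpa using (this.tendsto 0).mono_left (nhdsWithin_le_nhds (s := Ioi 0))
      have := h1.cpow (tendsto_const_nhds (x := (-σ : ℂ))) hsl
      simpa [fracSymbol] using this
  have heq := tendsto_nhds_unique hlim1 ((hlim2.const_mul (Real.Gamma σ : ℂ)).congr' (by
    filter_upwards [self_mem_nhdsWithin] with ε hε
    exact (integral_damped_kernel_mul hσ hε hWc hWi hF x).symm))
  have hΓ : (Real.Gamma σ : ℂ) ≠ 0 := by exact_mod_cast (Real.Gamma_pos_of_pos hσ).ne'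
  have hre : (∫ t, ((rlKernel σ t : ℝ) : ℂ) * W (x - t)) =
      ((∫ t, rlKernel σ t * w (x - t) : ℝ) : ℂ) := by
    simpa [hW] using integral_ofReal (𝕜 := ℂ) (μ := volume)
      (f := fun t => rlKernel σ t * w (x - t))
  rw [rlIntegral_eq_convolution]
  simp only [MeasureTheory.convolution_def, ContinuousLinearMap.mul_apply']
  rw [ofReal_mul, ← hre, heq]
  push_cast
  rw [← mul_assoc, one_div_mul_cancel hΓ, one_mul, Real.fourierInv_eq']
  congr 1
  ext ξ
  simp only [smul_eq_mul]
  rw [mul_left_comm]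
  congr 3
  simp
  ring

/-! ### Riemann-Liouville derivatives of test functions -/

/-- The complexification of a test function, as a Schwartz function. -/
noncomputable def IsTestFn.toSchwartz {ψ : ℝ → ℝ} (hψ : IsTestFn ψ) : SchwartzMap ℝ ℂ :=
  HasCompactSupport.toSchwartzMap (f := fun x => (ψ x : ℂ))
    (hψ.2.comp_left (g := fun y : ℝ => (y : ℂ)) ofReal_zero) (ofRealCLM.contDiff.comp hψ.1)

lemma IsTestFn.coe_toSchwartz {ψ : ℝ → ℝ} (hψ : IsTestFn ψ) :
    ⇑hψ.toSchwartz = fun x => (ψ x : ℂ) := rfl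

lemma IsTestFn.fourier_eq {ψ : ℝ → ℝ} (hψ : IsTestFn ψ) :
    𝓕 (fun x => (ψ x : ℂ)) = ⇑(𝓕 hψ.toSchwartz : SchwartzMap ℝ ℂ) := by
  rw [SchwartzMap.fourier_coe, hψ.coe_toSchwartz]

lemma IsTestFn.deriv {ψ : ℝ → ℝ} (hψ : IsTestFn ψ) : IsTestFn (deriv ψ) :=
  ⟨(contDiff_infty_iff_deriv.1 hψ.1).2, hψ.2.deriv⟩

lemma IsTestFn.comp_neg {ψ : ℝ → ℝ} (hψ : IsTestFn ψ) : IsTestFn fun x => ψ (-x) :=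
  ⟨hψ.1.comp contDiff_neg, hψ.2.comp_homeomorph (Homeomorph.neg ℝ)⟩

/-- Multipliers of at most quadratic growth map Schwartz functions into every `L^p`. -/
lemma memLp_mul_schwartz {g : ℝ → ℂ} (hg : Measurable g) {C : ℝ}
    (hC : ∀ ξ, ‖g ξ‖ ≤ C * (1 + ξ ^ 2)) (h : SchwartzMap ℝ ℂ) (p : ENNReal) :
    MemLp (fun ξ => g ξ * h ξ) p := by
  have htg : Function.HasTemperateGrowth fun ξ : ℝ => ((1 + ξ ^ 2 : ℝ) : ℂ) := by fun_prop
  have h1 := (SchwartzMap.smulLeftCLM ℂ (fun ξ : ℝ => ((1 + ξ ^ 2 : ℝ) : ℂ)) h).memLp p volume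
  refine (h1.const_mul (C : ℂ)).mono (hg.aestronglyMeasurable.mul
    h.continuous.aestronglyMeasurable) (Eventually.of_forall fun ξ => ?_)
  rw [SchwartzMap.smulLeftCLM_apply_apply htg, norm_mul, norm_mul, norm_smul, ← mul_assoc]
  refine mul_le_mul_of_nonneg_right ((hC ξ).trans ?_) (norm_nonneg _)
  rw [norm_real, norm_real, Real.norm_of_nonneg (by positivity : 0 ≤ 1 + ξ ^ 2)]
  exact mul_le_mul_of_nonneg_right (le_abs_self C) (by positivity)

lemma norm_fracSymbol_le {s : ℝ} (hs0 : 0 ≤ s) (hs2 : s ≤ 2) (ξ : ℝ) :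
    ‖fracSymbol s ξ‖ ≤ (2 * Real.pi) ^ 2 * (1 + ξ ^ 2) := by
  rw [norm_fracSymbol]
  have hpi := Real.pi_gt_three
  rcases le_total |2 * Real.pi * ξ| 1 with h | h
  · have := Real.rpow_le_one (abs_nonneg _) h hs0
    nlinarith [sq_nonneg ξ, sq_nonneg (2 * Real.pi * ξ)]
  · have h1 := Real.rpow_le_rpow_of_exponent_le h hs2
    rw [show (2 : ℝ) = ((2 : ℕ) : ℝ) by norm_num, Real.rpow_natCast] at h1
    push_cast at h1
    rw [sq_abs] at h1
    nlinarith [sq_nonneg (2 * Real.pi)]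

lemma memLp_fracSymbol_mul {s : ℝ} (hs0 : 0 ≤ s) (hs2 : s ≤ 2) {ψ : ℝ → ℝ}
    (hψ : IsTestFn ψ) (p : ENNReal) :
    MemLp (fun ξ => fracSymbol s ξ * 𝓕 (fun x => (ψ x : ℂ)) ξ) p := by
  rw [hψ.fourier_eq]
  exact memLp_mul_schwartz (measurable_fracSymbol s) (norm_fracSymbol_le hs0 hs2) _ p

lemma memLp_neg_fracSymbol_mul {s : ℝ} (hs0 : 0 ≤ s) (hs2 : s ≤ 2) {ψ : ℝ → ℝ}
    (hψ : IsTestFn ψ) (p : ENNReal) :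
    MemLp (fun ξ => fracSymbol s (-ξ) * 𝓕 (fun x => (ψ x : ℂ)) ξ) p := by
  rw [hψ.fourier_eq]
  refine memLp_mul_schwartz (C := (2 * Real.pi) ^ 2)
    ((measurable_fracSymbol s).comp measurable_neg) (fun ξ => ?_) _ p
  rw [Function.comp_apply, fracSymbol_neg, RCLike.norm_conj]
  exact norm_fracSymbol_le hs0 hs2 ξ

lemma IsTestFn.fourier_deriv {ψ : ℝ → ℝ} (hψ : IsTestFn ψ) (ξ : ℝ) :
    𝓕 (fun x => ((_root_.deriv ψ x : ℝ) : ℂ)) ξ =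
      (2 * Real.pi * I * ξ) * 𝓕 (fun x => (ψ x : ℂ)) ξ := by
  have hd : _root_.deriv (fun x => (ψ x : ℂ)) = fun x => ((_root_.deriv ψ x : ℝ) : ℂ) := by
    ext x
    exact ((hψ.1.differentiable (by simp)) x).hasDerivAt.ofReal_comp.deriv
  have := Real.fourier_deriv (f := fun x => (ψ x : ℂ)) hψ.toSchwartz.integrable
    hψ.toSchwartz.differentiable (by rw [hd]; exact hψ.deriv.toSchwartz.integrable)
  rw [← hd, this]
  rfl

lemma IsTestFn.deriv_eq_fourierInv {ψ : ℝ → ℝ} (hψ : IsTestFn ψ) (x : ℝ) :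
    ((_root_.deriv ψ x : ℝ) : ℂ) = 𝓕⁻ (fun ξ => fracSymbol 1 ξ * 𝓕 (fun x => (ψ x : ℂ)) ξ) x := by
  have h1 : (fun ξ => fracSymbol 1 ξ * 𝓕 (fun x => (ψ x : ℂ)) ξ) =
      𝓕 (fun x => ((_root_.deriv ψ x : ℝ) : ℂ)) := by
    ext ξ
    rw [hψ.fourier_deriv, fracSymbol, ofReal_one, cpow_one]
    ring
  have h2 : Integrable (𝓕 fun x => ((_root_.deriv ψ x : ℝ) : ℂ)) := by
    rw [hψ.deriv.fourier_eq]
    exact (𝓕 hψ.deriv.toSchwartz : SchwartzMap ℝ ℂ).integrable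
  have hc : Continuous fun x => ((_root_.deriv ψ x : ℝ) : ℂ) := hψ.deriv.toSchwartz.continuous
  rw [h1, hc.fourierInv_fourier_eq hψ.deriv.toSchwartz.integrable h2]

lemma floor_eq_one_of_mem_Ioo {s : ℝ} (hs1 : 1 < s) (hs2 : s < 2) : ⌊s⌋₊ = 1 := by
  rw [Nat.floor_eq_iff (by linarith)]
  norm_num
  exact ⟨hs1.le, by linarith⟩

/-- Both derivatives in the Riemann-Liouville derivative of order `s ∈ (1, 2)` fall on the test
function. -/
lemma rlDeriv_eq_rlIntegral {s : ℝ} (hs1 : 1 < s) (hs2 : s < 2) {ψ : ℝ → ℝ} (hψ : IsTestFn ψ) :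
    rlDeriv s ψ = rlIntegral (2 - s) (deriv (deriv ψ)) := by
  have hσ : 0 < 2 - s := by linarith
  have key : ∀ φ, IsTestFn φ → deriv (rlIntegral (2 - s) φ) = rlIntegral (2 - s) (deriv φ) :=
    fun φ hφ => funext fun x =>
      (hasDerivAt_rlIntegral hσ (hφ.1.of_le (by exact_mod_cast le_top)) hφ.2 x).deriv
  rw [rlDeriv, floor_eq_one_of_mem_Ioo hs1 hs2]
  norm_num [iteratedDeriv_succ, iteratedDeriv_zero]
  rw [key ψ hψ, key _ hψ.deriv]

theorem rlDeriv_eq_fourierInv {s : ℝ} (hs1 : 1 < s) (hs2 : s < 2) {ψ : ℝ → ℝ}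
    (hψ : IsTestFn ψ) (x : ℝ) :
    (rlDeriv s ψ x : ℂ) = 𝓕⁻ (fun ξ => fracSymbol s ξ * 𝓕 (fun x => (ψ x : ℂ)) ξ) x := by
  have h1 : (fun ξ => fracSymbol (-(2 - s)) ξ * 𝓕 (fun x => ((deriv (deriv ψ) x : ℝ) : ℂ)) ξ) =
      fun ξ => fracSymbol s ξ * 𝓕 (fun x => (ψ x : ℂ)) ξ := by
    ext ξ
    rw [hψ.deriv.fourier_deriv, hψ.fourier_deriv, ← mul_assoc (2 * (Real.pi : ℂ) * I * ξ),
      ← pow_two, ← mul_assoc, fracSymbol_mul_sq (by linarith) (by linarith)]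
    congr 2
    ring
  rw [rlDeriv_eq_rlIntegral hs1 hs2 hψ, ← h1]
  refine rlIntegral_eq_fourierInv (by linarith) hψ.deriv.deriv.1.continuous hψ.deriv.deriv.2 ?_ ?_ x
  · rw [hψ.deriv.deriv.fourier_eq]
    exact (𝓕 hψ.deriv.deriv.toSchwartz : SchwartzMap ℝ ℂ).integrable
  · rw [h1]
    exact memLp_one_iff_integrable.1 (memLp_fracSymbol_mul (by linarith) hs2.le hψ 1)

lemma rlIntegralStar_eq_rlIntegral_neg (σ : ℝ) (w : ℝ → ℝ) (x : ℝ) :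
    rlIntegralStar σ w x = rlIntegral σ (fun y => w (-y)) (-x) := by
  rw [rlIntegral, rlIntegralStar]
  congr 1
  rw [← integral_Iic_eq_integral_Iio, ← integral_comp_neg_Ioi]
  simp [sub_eq_add_neg, add_comm]

lemma rlDerivStar_eq_rlDeriv_neg (s : ℝ) (w : ℝ → ℝ) (x : ℝ) :
    rlDerivStar s w x = rlDeriv s (fun y => w (-y)) (-x) := by
  have : rlIntegralStar (((⌊s⌋₊ + 1 : ℕ) : ℝ) - s) w =
      fun x => rlIntegral (((⌊s⌋₊ + 1 : ℕ) : ℝ) - s) (fun y => w (-y)) (-x) :=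
    funext fun x => rlIntegralStar_eq_rlIntegral_neg _ _ _
  rw [rlDerivStar, this, iteratedDeriv_comp_neg, smul_eq_mul, ← mul_assoc, ← mul_pow]
  simp [rlDeriv]

theorem rlDerivStar_eq_fourierInv {s : ℝ} (hs1 : 1 < s) (hs2 : s < 2) {ψ : ℝ → ℝ}
    (hψ : IsTestFn ψ) (x : ℝ) :
    (rlDerivStar s ψ x : ℂ) =
      𝓕⁻ (fun ξ => fracSymbol s (-ξ) * 𝓕 (fun x => (ψ x : ℂ)) ξ) x := by
  rw [rlDerivStar_eq_rlDeriv_neg, rlDeriv_eq_fourierInv hs1 hs2 hψ.comp_neg]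
  have h2 (ξ : ℝ) : 𝓕 (fun x => (ψ (-x) : ℂ)) ξ = 𝓕 (fun x => (ψ x : ℂ)) (-ξ) :=
    Real.fourier_comp_linearIsometry (LinearIsometryEquiv.neg ℝ) (fun x => (ψ x : ℂ)) ξ
  rw [Real.fourierInv_eq', Real.fourierInv_eq', ← integral_neg_eq_self]
  simp [h2]

/-! ### The Plancherel transform of real functions -/

lemma IsTestFn.fourierInv_eq {φ : ℝ → ℝ} (hφ : IsTestFn φ) :
    𝓕⁻ (fun x => (φ x : ℂ)) = ⇑(𝓕⁻ hφ.toSchwartz : SchwartzMap ℝ ℂ) := by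
  rw [SchwartzMap.fourierInv_coe, hφ.coe_toSchwartz]

/-- The inverse Fourier transform on `L²` is characterised by its pairing with test functions. -/
lemma integral_testFn_smul_fourierInv (g : Lp ℂ 2 (volume : Measure ℝ)) {φ : ℝ → ℝ}
    (hφ : IsTestFn φ) :
    ∫ x, φ x • (𝓕⁻ g : Lp ℂ 2 (volume : Measure ℝ)) x =
      ∫ ξ, 𝓕⁻ (fun x => (φ x : ℂ)) ξ * g ξ := by
  have h := congrArg (fun T => T hφ.toSchwartz) (Lp.fourierInv_toTemperedDistribution_eq g)
  simp only [Lp.toTemperedDistribution_apply] at h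
  rw [TemperedDistribution.fourierInv_apply, Lp.toTemperedDistribution_apply,
    ← hφ.fourierInv_eq] at h
  simpa [hφ.coe_toSchwartz] using h.symm

lemma locallyIntegrable_lp {E : Type*} [NormedAddCommGroup E]
    (g : Lp E 2 (volume : Measure ℝ)) : LocallyIntegrable g :=
  (Lp.memLp g).locallyIntegrable one_le_two

/-- On `L¹ ∩ L²` the inverse Plancherel transform is given by the inverse Fourier integral. -/
lemma coeFn_fourierInv_toLp {h : ℝ → ℂ} (h1 : Integrable h) (h2 : MemLp h 2) :
    ⇑(𝓕⁻ (h2.toLp h) : Lp ℂ 2 (volume : Measure ℝ)) =ᵐ[volume] 𝓕⁻ h := by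
  have hcont : Continuous (𝓕⁻ h) := by
    have : Continuous (𝓕 h) :=
      VectorFourier.fourierIntegral_continuous Real.continuous_fourierChar continuous_inner h1
    rw [funext (Real.fourierInv_eq_fourier_neg h)]
    exact this.comp continuous_neg
  refine ae_eq_of_integral_contDiff_smul_eq (locallyIntegrable_lp _) hcont.locallyIntegrable
    fun φ hφ hc => ?_
  have hφ' : IsTestFn φ := ⟨hφ, hc⟩
  have hflip : ∫ ξ, 𝓕 h ξ • ((φ (-ξ) : ℝ) : ℂ) = ∫ x, h x • 𝓕 (fun x => (φ (-x) : ℂ)) x := by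
    simpa using! VectorFourier.integral_fourierIntegral_smul_eq_flip (L := innerₗ ℝ)
      (μ := volume) (ν := volume) Real.continuous_fourierChar continuous_inner
      h1 hφ'.comp_neg.toSchwartz.integrable
  rw [integral_testFn_smul_fourierInv _ hφ']
  calc ∫ ξ, 𝓕⁻ (fun x => (φ x : ℂ)) ξ * h2.toLp h ξ
      = ∫ ξ, h ξ • 𝓕 (fun x => (φ (-x) : ℂ)) ξ := by
        refine integral_congr_ae ?_
        filter_upwards [h2.coeFn_toLp] with ξ hξ
        rw [hξ, Real.fourierInv_eq_fourier_comp_neg, smul_eq_mul, mul_comm]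
    _ = ∫ x, φ x • 𝓕⁻ h x := by
        rw [← hflip, ← integral_neg_eq_self]
        refine integral_congr_ae (Eventually.of_forall fun x => ?_)
        simp [Real.fourierInv_eq_fourier_neg, mul_comm]

lemma fourierInv_ofReal_neg (φ : ℝ → ℝ) (ξ : ℝ) :
    𝓕⁻ (fun x => (φ x : ℂ)) (-ξ) = (starRingEnd ℂ) (𝓕⁻ (fun x => (φ x : ℂ)) ξ) := by
  rw [Real.fourierInv_eq', Real.fourierInv_eq', ← integral_conj]
  congr 1
  ext x
  simp [← Complex.exp_conj, map_ofNat]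

/-- The inverse Plancherel transform takes `conj (g (-ξ))` to the complex conjugate. -/
lemma fourierInv_conj_comp_neg {g g' : Lp ℂ 2 (volume : Measure ℝ)}
    (h : ∀ᵐ ξ, g' ξ = (starRingEnd ℂ) (g (-ξ))) :
    ∀ᵐ x, (𝓕⁻ g' : Lp ℂ 2 (volume : Measure ℝ)) x =
      (starRingEnd ℂ) ((𝓕⁻ g : Lp ℂ 2 (volume : Measure ℝ)) x) := by
  have hloc : LocallyIntegrable fun x =>
      (starRingEnd ℂ) ((𝓕⁻ g : Lp ℂ 2 (volume : Measure ℝ)) x) :=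
    ((Lp.memLp (𝓕⁻ g : Lp ℂ 2 (volume : Measure ℝ))).star).locallyIntegrable one_le_two
  refine ae_eq_of_integral_contDiff_smul_eq (locallyIntegrable_lp _) hloc fun φ hφ hc => ?_
  have hφ' : IsTestFn φ := ⟨hφ, hc⟩
  have e : ∫ x, φ x • (starRingEnd ℂ) ((𝓕⁻ g : Lp ℂ 2 (volume : Measure ℝ)) x) =
      (starRingEnd ℂ) (∫ x, φ x • (𝓕⁻ g : Lp ℂ 2 (volume : Measure ℝ)) x) := by
    rw [← integral_conj]
    simp
  rw [e, integral_testFn_smul_fourierInv _ hφ', integral_testFn_smul_fourierInv _ hφ',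
    ← integral_conj, ← integral_neg_eq_self (fun ξ => (starRingEnd ℂ) _)]
  refine integral_congr_ae ?_
  filter_upwards [h] with ξ hξ
  rw [hξ, map_mul, fourierInv_ofReal_neg, conj_conj]

lemma coeFn_ofReal_compLp (w : L2R) :
    ⇑(ofRealCLM.compLp w) =ᵐ[volume] fun x => ((w x : ℝ) : ℂ) :=
  ofRealCLM.coeFn_compLp w

lemma ofReal_compLp_injective :
    Function.Injective fun w : L2R => (ofRealCLM.compLp w : Lp ℂ 2 (volume : Measure ℝ)) := by
  intro v w h
  refine Lp.ext ?_
  filter_upwards [coeFn_ofReal_compLp v, coeFn_ofReal_compLp w] with x hv hw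
  have : (ofRealCLM.compLp v : Lp ℂ 2 (volume : Measure ℝ)) = ofRealCLM.compLp w := h
  rw [this, hw] at hv
  exact_mod_cast hv.symm

lemma plancherel_injective : Function.Injective plancherel := fun _ _ h =>
  ofReal_compLp_injective ((Lp.fourierTransformₗᵢ ℝ ℂ).injective h)

lemma fourierInv_plancherel (w : L2R) : 𝓕⁻ (plancherel w) = ofRealCLM.compLp w :=
  FourierTransform.fourierInv_fourier_eq _

/-- The transform of a real function is Hermitian: the Hermitian reflection of `ŵ` and `ŵ` itself
have the same inverse transform. -/
lemma plancherel_neg (w : L2R) :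
    ∀ᵐ ξ, plancherel w (-ξ) = (starRingEnd ℂ) (plancherel w ξ) := by
  have hm : MemLp (fun ξ => (starRingEnd ℂ) (plancherel w (-ξ))) 2 :=
    ((Lp.memLp (plancherel w)).comp_measurePreserving
      (Measure.measurePreserving_neg volume)).star
  have h1 := fourierInv_conj_comp_neg (g := plancherel w) hm.coeFn_toLp
  have h2 : 𝓕⁻ (hm.toLp _) = 𝓕⁻ (plancherel w) := by
    refine Lp.ext ?_
    filter_upwards [h1, coeFn_ofReal_compLp w] with x h1 h2
    rw [h1, fourierInv_plancherel, h2, conj_ofReal]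
  have h3 : hm.toLp _ = plancherel w := (Lp.fourierTransformₗᵢ ℝ ℂ).symm.injective h2
  filter_upwards [hm.coeFn_toLp] with ξ hξ
  rw [h3] at hξ
  rw [hξ, conj_conj]

/-- Every Hermitian square integrable function is the transform of a real function. -/
lemma exists_plancherel_eq {g : ℝ → ℂ} (hg : MemLp g 2)
    (hh : ∀ᵐ ξ, g (-ξ) = (starRingEnd ℂ) (g ξ)) :
    ∃ w : L2R, plancherel w =ᵐ[volume] g := by
  set G : Lp ℂ 2 (volume : Measure ℝ) := hg.toLp g with hG
  set W : Lp ℂ 2 (volume : Measure ℝ) := 𝓕⁻ G with hW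
  have hneg : ∀ᵐ ξ, G (-ξ) = g (-ξ) :=
    (Measure.measurePreserving_neg volume).quasiMeasurePreserving.ae hg.coeFn_toLp
  have hreal : ∀ᵐ x, W x = (starRingEnd ℂ) (W x) := by
    refine fourierInv_conj_comp_neg (g := G) (g' := G) ?_
    filter_upwards [hneg, hh, hg.coeFn_toLp] with ξ h1 h2 h3
    rw [h1, h2, conj_conj, h3]
  refine ⟨reCLM.compLp W, ?_⟩
  have : ofRealCLM.compLp (reCLM.compLp W : L2R) = W := by
    refine Lp.ext ?_
    filter_upwards [coeFn_ofReal_compLp (reCLM.compLp W), reCLM.coeFn_compLp W, hreal]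
      with x h1 h2 h3
    rw [h1, h2]
    exact conj_eq_iff_re.1 h3.symm
  rw [plancherel, this, hW, FourierTransform.fourier_fourierInv_eq]
  exact hg.coeFn_toLp

lemma norm_plancherel (w : L2R) : ‖plancherel w‖ = ‖w‖ := by
  rw [plancherel, Lp.norm_fourier_eq, Lp.norm_def, Lp.norm_def]
  congr 1
  refine eLpNorm_congr_norm_ae ?_
  filter_upwards [coeFn_ofReal_compLp w] with x hx
  rw [hx, norm_real]

/-- If `D` is obtained from a test function `ψ` by the Fourier multiplier `m`, and `v` is obtained
from `u` by the adjoint multiplier, then the pairings `⟨u, D⟩` and `⟨v, ψ⟩` agree. -/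
lemma integral_mul_eq_of_multiplier {ψ D : ℝ → ℝ} (hψ : IsTestFn ψ) {m : ℝ → ℂ}
    (hD : ∀ x, (D x : ℂ) = 𝓕⁻ (fun ξ => m ξ * 𝓕 (fun x => (ψ x : ℂ)) ξ) x)
    (h1 : Integrable fun ξ => m ξ * 𝓕 (fun x => (ψ x : ℂ)) ξ)
    (h2 : MemLp (fun ξ => m ξ * 𝓕 (fun x => (ψ x : ℂ)) ξ) 2) {u v : L2R}
    (hv : ∀ᵐ ξ, plancherel v ξ = (starRingEnd ℂ) (m ξ) * plancherel u ξ) :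
    Integrable (fun x => u x * D x) ∧ ∫ x, u x * D x = ∫ x, v x * ψ x := by
  set U : Lp ℂ 2 (volume : Measure ℝ) := ofRealCLM.compLp u
  set V : Lp ℂ 2 (volume : Measure ℝ) := ofRealCLM.compLp v
  set E : Lp ℂ 2 (volume : Measure ℝ) := 𝓕⁻ (h2.toLp _) with hE
  have hUE : ∀ᵐ x, inner ℂ (U x) (E x) = ((u x * D x : ℝ) : ℂ) := by
    filter_upwards [coeFn_ofReal_compLp u, coeFn_fourierInv_toLp h1 h2] with x hx hx'
    rw [hx, hE, hx', ← hD]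
    simp [mul_comm]
  have hVP : ∀ᵐ x, inner ℂ (V x) (hψ.toSchwartz.toLp 2 volume x) = ((v x * ψ x : ℝ) : ℂ) := by
    filter_upwards [coeFn_ofReal_compLp v, hψ.toSchwartz.coeFn_toLp 2 volume] with x hx hx'
    rw [hx, hx', hψ.coe_toSchwartz]
    simp [mul_comm]
  have hint : Integrable fun x => ((u x * D x : ℝ) : ℂ) :=
    (L2.integrable_inner (𝕜 := ℂ) U E).congr hUE
  refine ⟨by simpa using! hint.re, ?_⟩
  have key : inner ℂ U E = inner ℂ V (hψ.toSchwartz.toLp 2 volume) := by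
    rw [← Lp.inner_fourier_eq U E, ← Lp.inner_fourier_eq V, hE,
      FourierTransform.fourier_fourierInv_eq, SchwartzMap.toLp_fourier_eq, L2.inner_def,
      L2.inner_def]
    refine integral_congr_ae ?_
    filter_upwards [hv, h2.coeFn_toLp,
      (𝓕 hψ.toSchwartz : SchwartzMap ℝ ℂ).coeFn_toLp 2 volume] with ξ h3 h4 h5
    have h3' : (𝓕 V : Lp ℂ 2 (volume : Measure ℝ)) ξ =
      (starRingEnd ℂ) (m ξ) * (𝓕 U : Lp ℂ 2 (volume : Measure ℝ)) ξ := h3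
    rw [h3', h4, h5, ← hψ.fourier_eq]
    simp only [RCLike.inner_apply, map_mul, conj_conj]
    ring
  rw [L2.inner_def, L2.inner_def, integral_congr_ae hUE, integral_congr_ae hVP] at key
  have h6 := integral_ofReal (𝕜 := ℂ) (μ := volume) (f := fun x => u x * D x)
  have h7 := integral_ofReal (𝕜 := ℂ) (μ := volume) (f := fun x => v x * ψ x)
  have : ((∫ x, u x * D x : ℝ) : ℂ) = ((∫ x, v x * ψ x : ℝ) : ℂ) := by
    exact h6.symm.trans (key.trans h7)
  exact_mod_cast this

/-! ### The symbol of the equation -/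

/-- The symbol of the operator `p D^s + q D^{s*} + a D + b`; since `(-2πiξ) ^ s` is the value at
`-ξ` of `(2πiξ) ^ s`, it is written with `fracSymbol s (-ξ)`. -/
noncomputable def opSymbol (p q a b s ξ : ℝ) : ℂ :=
  p * fracSymbol s ξ + q * fracSymbol s (-ξ) + a * fracSymbol 1 ξ + b

lemma measurable_opSymbol (p q a b s : ℝ) : Measurable (opSymbol p q a b s) := by
  have := measurable_fracSymbol s
  have h1 := measurable_fracSymbol 1
  unfold opSymbol
  fun_prop

lemma opSymbol_neg (p q a b s ξ : ℝ) :
    opSymbol p q a b s (-ξ) = (starRingEnd ℂ) (opSymbol p q a b s ξ) := by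
  simp [opSymbol, fracSymbol_neg]

lemma fracSymbol_of_pos {s ξ : ℝ} (hξ : 0 < ξ) :
    fracSymbol s ξ = ((2 * Real.pi * ξ) ^ s * Real.cos (s * Real.pi / 2) : ℝ) +
      ((2 * Real.pi * ξ) ^ s * Real.sin (s * Real.pi / 2) : ℝ) * I := by
  have hw : 0 < 2 * Real.pi * ξ := by positivity
  have h0 : (2 * Real.pi * ξ * I : ℂ) = ((2 * Real.pi * ξ : ℝ) : ℂ) * I := by push_cast; ring
  rw [fracSymbol, h0, cpow_def_of_ne_zero (mul_ne_zero (ofReal_ne_zero.2 hw.ne') I_ne_zero),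
    log_ofReal_mul hw I_ne_zero, log_I, add_mul, Complex.exp_add, Real.rpow_def_of_pos hw]
  have h1 : (Real.pi / 2 * I * s : ℂ) = ((s * Real.pi / 2 : ℝ) : ℂ) * I := by push_cast; ring
  rw [h1, exp_mul_I, ← ofReal_cos, ← ofReal_sin]
  push_cast
  ring

/-- The squared modulus of the symbol is the generalized polynomial with the coefficients `C_j`. -/
lemma sq_norm_opSymbol (p q a b : ℝ) {μ : ℝ} (hμ : μ < 2) (ξ : ℝ) :
    ‖opSymbol p q a b (2 - μ) ξ‖ ^ 2 =
      ∑ j ∈ ({1, 2, 3, 4, 5} : Finset ℕ),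
        coefC p q a b μ j * |2 * Real.pi * ξ| ^ (2 * sigmaExp μ j) := by
  wlog h : 0 ≤ ξ generalizing ξ
  · have := this (-ξ) (by linarith)
    rwa [opSymbol_neg, RCLike.norm_conj, mul_neg, abs_neg] at this
  rcases h.eq_or_lt with rfl | hξ
  · have h1 : (2 : ℂ) - μ ≠ 0 := by
      intro h
      have : (2 : ℝ) - μ = 0 := by exact_mod_cast h
      linarith
    have h2 : 2 * (2 - μ) ≠ 0 := by linarith
    have h3 : (2 * ((3 - μ) / 2)) ≠ 0 := by linarith
    have h4 : 2 * ((2 - μ) / 2) ≠ 0 := by linarith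
    simp [opSymbol, fracSymbol, h1, sigmaExp, coefC, Real.zero_rpow h2, Real.zero_rpow h3,
      Real.zero_rpow h4]
  · set s := 2 - μ with hs
    set w := 2 * Real.pi * ξ with hw
    have hwpos : 0 < w := by positivity
    have hc1 : Real.cos (s * Real.pi) =
        Real.cos (s * Real.pi / 2) ^ 2 - Real.sin (s * Real.pi / 2) ^ 2 := by
      rw [← Real.cos_two_mul']; ring_nf
    have hc2 : Real.cos ((3 - μ) / 2 * Real.pi) = -Real.sin (s * Real.pi / 2) := by
      rw [← Real.cos_add_pi_div_two]
      congr 1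
      rw [hs]
      ring
    have e1 : w ^ (2 * s) = (w ^ s) ^ 2 := by
      rw [mul_comm, Real.rpow_mul hwpos.le]; norm_num
    have e2 : w ^ (2 * ((3 - μ) / 2)) = w ^ s * w := by
      rw [← Real.rpow_add_one hwpos.ne', hs]; ring_nf
    have e4 : w ^ (2 * ((2 - μ) / 2)) = w ^ s := by
      rw [hs]; ring_nf
    have hf1 : fracSymbol 1 ξ = (w : ℂ) * I := by
      simp [fracSymbol, hw]
    have hP : opSymbol p q a b s ξ =
        (((p + q) * (w ^ s * Real.cos (s * Real.pi / 2)) + b : ℝ) : ℂ) +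
        (((p - q) * (w ^ s * Real.sin (s * Real.pi / 2)) + a * w : ℝ) : ℂ) * I := by
      rw [opSymbol, fracSymbol_neg, fracSymbol_of_pos hξ, hf1, ← hw]
      simp only [map_add, map_mul, conj_ofReal, conj_I]
      push_cast
      ring
    rw [hP, ← normSq_eq_norm_sq, normSq_add_mul_I]
    simp only [Finset.mem_insert, Finset.mem_singleton, OfNat.one_ne_ofNat,
      Nat.reduceEqDiff, or_self, not_false_eq_true, Finset.sum_insert, Finset.sum_singleton,
      coefC, sigmaExp, abs_of_pos hwpos]
    rw [← hs, e1, e2, e4, hc1, hc2]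
    norm_num
    rw [div_mul_eq_mul_div s 2]
    linear_combination (w ^ s) ^ 2 * (p^2+q^2) * Real.sin_sq_add_cos_sq (s * Real.pi / 2)

lemma coefC_one_pos {p q μ : ℝ} (a b : ℝ) (hpq : p ^ 2 + q ^ 2 ≠ 0) (hμ₀ : 0 < μ) (hμ₁ : μ < 1) :
    0 < coefC p q a b μ 1 := by
  have hpi := Real.pi_pos
  have hc : Real.cos ((2 - μ) * Real.pi / 2) < 0 :=
    Real.cos_neg_of_pi_div_two_lt_of_lt (by nlinarith) (by nlinarith)
  have hs : 0 < Real.sin ((2 - μ) * Real.pi / 2) :=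
    Real.sin_pos_of_pos_of_lt_pi (by nlinarith) (by nlinarith)
  have h2 : Real.cos ((2 - μ) * Real.pi) =
      Real.cos ((2 - μ) * Real.pi / 2) ^ 2 - Real.sin ((2 - μ) * Real.pi / 2) ^ 2 := by
    rw [← Real.cos_two_mul']; ring_nf
  have h1 := Real.sin_sq_add_cos_sq ((2 - μ) * Real.pi / 2)
  simp only [coefC, sigmaExp]
  rw [h2]
  set c := Real.cos ((2 - μ) * Real.pi / 2)
  set S := Real.sin ((2 - μ) * Real.pi / 2)
  have e : p ^ 2 + q ^ 2 + 2 * p * q * (c ^ 2 - S ^ 2) =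
      ((p + q) * c) ^ 2 + ((p - q) * S) ^ 2 := by
    linear_combination -(p ^ 2 + q ^ 2) * h1
  rw [e]
  by_cases h : p + q = 0
  · have hne : p - q ≠ 0 := by
      intro h'
      have hp : p = 0 := by linarith
      have hq : q = 0 := by linarith
      simp [hp, hq] at hpq
    have := mul_ne_zero hne hs.ne'
    positivity
  · have := mul_ne_zero h hc.ne
    positivity

/-- Positivity of the generalized polynomial in the variable `l = α r`, for each of the three
alternatives with a parameter `α`. The powers of `l` decrease with their index if `1 ≤ l` and
increase if `l ≤ 1`; bounding them by a single one of them leaves a multiple of the sum of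
leading, respectively trailing, coefficients that is positive by assumption. -/
lemma sum_pos_of_rescaled {t₁ t₂ t₃ t₄ t₅ l σ₁ σ₂ σ₄ : ℝ} (hl : 0 < l) (h21 : σ₂ ≤ σ₁)
    (h32 : 1 ≤ σ₂) (h43 : σ₄ ≤ 1) (h4 : 0 ≤ σ₄) (ht1 : 0 < t₁) (ht3 : 0 ≤ t₃) (ht5 : 0 < t₅)
    (h : (0 ≤ t₂ ∧ t₄ < 0 ∧ 0 < t₁ + t₂ + t₃ + t₄ ∧ 0 < t₄ + t₅) ∨
      (t₂ < 0 ∧ 0 ≤ t₄ ∧ 0 < t₁ + t₂ ∧ 0 < t₂ + t₃ + t₄ + t₅) ∨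
      (t₂ < 0 ∧ t₄ < 0 ∧ 0 < t₁ + t₂ + t₄ ∧ 0 < t₂ + t₄ + t₅)) :
    0 < t₁ * l ^ (2 * σ₁) + t₂ * l ^ (2 * σ₂) + t₃ * l ^ (2 * (1 : ℝ)) + t₄ * l ^ (2 * σ₄) +
      t₅ := by
  have p1 : 0 < l ^ (2 * σ₁) := by positivity
  have p2 : 0 < l ^ (2 * σ₂) := by positivity
  have p3 : 0 < l ^ (2 * (1 : ℝ)) := by positivity
  have p4 : 0 < l ^ (2 * σ₄) := by positivity
  rcases le_total 1 l with hl1 | hl1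
  · have q1 : l ^ (2 * σ₂) ≤ l ^ (2 * σ₁) := Real.rpow_le_rpow_of_exponent_le hl1 (by linarith)
    have q2 : l ^ (2 * (1 : ℝ)) ≤ l ^ (2 * σ₂) := Real.rpow_le_rpow_of_exponent_le hl1 (by linarith)
    have q3 : l ^ (2 * σ₄) ≤ l ^ (2 * (1 : ℝ)) := Real.rpow_le_rpow_of_exponent_le hl1 (by linarith)
    generalize l ^ (2 * σ₁) = L1 at *
    generalize l ^ (2 * σ₂) = L2 at *
    generalize l ^ (2 * (1 : ℝ)) = L3 at *
    generalize l ^ (2 * σ₄) = L4 at *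
    rcases h with ⟨h2, h4, hA, -⟩ | ⟨h2, h4, hA, -⟩ | ⟨h2, h4, hA, -⟩
    · have := mul_pos hA p4
      have e1 := mul_le_mul_of_nonneg_left (q3.trans (q2.trans q1)) ht1.le
      have e2 := mul_le_mul_of_nonneg_left (q3.trans q2) h2
      have e3 := mul_le_mul_of_nonneg_left q3 ht3
      linarith
    · have := mul_pos hA p2
      have e1 := mul_le_mul_of_nonneg_left q1 ht1.le
      have e3 := mul_nonneg ht3 p3.le
      have e4 := mul_nonneg h4 p4.le
      linarith
    · have := mul_pos hA p2
      have e1 := mul_le_mul_of_nonneg_left q1 ht1.le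
      have e3 := mul_nonneg ht3 p3.le
      have e4 := mul_le_mul_of_nonpos_left (q3.trans q2) h4.le
      linarith
  · have q1 : l ^ (2 * σ₁) ≤ l ^ (2 * σ₂) :=
      Real.rpow_le_rpow_of_exponent_ge hl hl1 (by linarith)
    have q2 : l ^ (2 * σ₂) ≤ l ^ (2 * (1 : ℝ)) :=
      Real.rpow_le_rpow_of_exponent_ge hl hl1 (by linarith)
    have q3 : l ^ (2 * (1 : ℝ)) ≤ l ^ (2 * σ₄) :=
      Real.rpow_le_rpow_of_exponent_ge hl hl1 (by linarith)
    have q4 : l ^ (2 * σ₄) ≤ 1 := Real.rpow_le_one hl.le hl1 (by linarith)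
    generalize l ^ (2 * σ₁) = L1 at *
    generalize l ^ (2 * σ₂) = L2 at *
    generalize l ^ (2 * (1 : ℝ)) = L3 at *
    generalize l ^ (2 * σ₄) = L4 at *
    have e1 := mul_pos ht1 p1
    have e3' := mul_nonneg ht3 p3.le
    rcases h with ⟨h2, h4, -, hB⟩ | ⟨h2, h4, -, hB⟩ | ⟨h2, h4, -, hB⟩
    · have e2 := mul_nonneg h2 p2.le
      have e4 := mul_le_mul_of_nonpos_left q4 h4.le
      linarith
    · have := mul_pos hB p3
      have e2 := mul_le_mul_of_nonpos_left q2 h2.le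
      have e4 := mul_le_mul_of_nonneg_left q3 h4
      have e5 := mul_le_mul_of_nonneg_left (q3.trans q4) ht5.le
      linarith
    · have e2 := mul_le_mul_of_nonpos_left (q2.trans (q3.trans q4)) h2.le
      have e4 := mul_le_mul_of_nonpos_left q4 h4.le
      linarith

lemma sum_coefC_rpow_pos {p q a b μ : ℝ} (hb : b ≠ 0) (hpq : p ^ 2 + q ^ 2 ≠ 0)
    (hμ₀ : 0 < μ) (hμ₁ : μ < 1) (hcond : CoefCondition p q a b μ) {r : ℝ} (hr : 0 ≤ r) :
    0 < ∑ j ∈ ({1, 2, 3, 4, 5} : Finset ℕ), coefC p q a b μ j * r ^ (2 * sigmaExp μ j) := by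
  have hC1 := coefC_one_pos a b hpq hμ₀ hμ₁
  have hC3 : 0 ≤ coefC p q a b μ 3 := by simp only [coefC]; positivity
  have hC5 : coefC p q a b μ 5 = b ^ 2 := rfl
  have hb2 : 0 < b ^ 2 := by positivity
  have hs3 : sigmaExp μ 3 = 1 := rfl
  have hs5 : sigmaExp μ 5 = 0 := rfl
  have h21 : sigmaExp μ 2 ≤ sigmaExp μ 1 := by simp only [sigmaExp]; linarith
  have h32 : 1 ≤ sigmaExp μ 2 := by simp only [sigmaExp]; linarith
  have h43 : sigmaExp μ 4 ≤ 1 := by simp only [sigmaExp]; linarith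
  have h4 : 0 < sigmaExp μ 4 := by simp only [sigmaExp]; linarith
  rcases hr.eq_or_lt with rfl | hr
  · have n1 : 2 * sigmaExp μ 1 ≠ 0 := by linarith
    have n2 : 2 * sigmaExp μ 2 ≠ 0 := by linarith
    have n4 : 2 * sigmaExp μ 4 ≠ 0 := by linarith
    simpa [Real.zero_rpow n1, Real.zero_rpow n2, Real.zero_rpow n4, hs3, hs5, hC5] using hb2
  have hsum : ∀ f : ℕ → ℝ, ∑ j ∈ ({1, 2, 3, 4, 5} : Finset ℕ), f j =
      f 1 + f 2 + f 3 + f 4 + f 5 := fun f => by simp [add_assoc]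
  have hsum4 : ∀ f : ℕ → ℝ, ∑ j ∈ ({1, 2, 3, 4} : Finset ℕ), f j =
      f 1 + f 2 + f 3 + f 4 := fun f => by simp [add_assoc]
  rw [hsum]
  -- The substitution `r = l / α` turns the coefficients `C_j` into `t α j`, which are the terms of
  -- the sums in the hypothesis.
  obtain ⟨t, ht⟩ : ∃ t : ℝ → ℕ → ℝ,
      ∀ α j, t α j = coefC p q a b μ j * α ^ (-(2 * sigmaExp μ j)) := ⟨_, fun _ _ => rfl⟩
  have main : ∀ α : ℝ, 0 < α →
      ((0 ≤ t α 2 ∧ t α 4 < 0 ∧ 0 < t α 1 + t α 2 + t α 3 + t α 4 ∧ 0 < t α 4 + b ^ 2) ∨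
      (t α 2 < 0 ∧ 0 ≤ t α 4 ∧ 0 < t α 1 + t α 2 ∧ 0 < t α 2 + t α 3 + t α 4 + b ^ 2) ∨
      (t α 2 < 0 ∧ t α 4 < 0 ∧ 0 < t α 1 + t α 2 + t α 4 ∧ 0 < t α 2 + t α 4 + b ^ 2)) →
      0 < coefC p q a b μ 1 * r ^ (2 * sigmaExp μ 1) + coefC p q a b μ 2 * r ^ (2 * sigmaExp μ 2) +
        coefC p q a b μ 3 * r ^ (2 * sigmaExp μ 3) + coefC p q a b μ 4 * r ^ (2 * sigmaExp μ 4) +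
        coefC p q a b μ 5 * r ^ (2 * sigmaExp μ 5) := fun α hα h => by
    have hscale : ∀ j, coefC p q a b μ j * r ^ (2 * sigmaExp μ j) =
        t α j * (r * α) ^ (2 * sigmaExp μ j) := fun j => by
      rw [ht, Real.mul_rpow hr.le hα.le, Real.rpow_neg hα.le]
      field_simp
    rw [hscale 1, hscale 2, hscale 3, hscale 4, hC5, hs5, hs3, mul_zero, Real.rpow_zero,
      mul_one (b ^ 2)]
    refine sum_pos_of_rescaled (mul_pos hr hα) h21 h32 h43 h4.le ?_ ?_ hb2 h
    · rw [ht]; exact mul_pos hC1 (by positivity)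
    · rw [ht]; positivity
  have hdiv : ∀ {α : ℝ}, 0 < α → ∀ j, coefC p q a b μ j / α ^ (2 * sigmaExp μ j - 1) =
      α * t α j := fun {α} hα j => by
    rw [ht, Real.rpow_sub_one hα.ne', Real.rpow_neg hα.le]
    field_simp
  rcases hcond with ⟨h2, h4'⟩ | ⟨h2, h4', α, hα, hA, hB⟩ | ⟨h2, h4', α, hα, hA, hB⟩ |
    ⟨h2, h4', α, hα, hA, hB⟩
  · have h1 : 0 < r ^ (2 * sigmaExp μ 1) := by positivity
    rw [hC5, hs5, mul_zero, Real.rpow_zero, mul_one]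
    positivity
  · refine main α hα (Or.inl ?_)
    have hp2 : 0 < α ^ (-(2 * sigmaExp μ 2)) := by positivity
    have hp4 : 0 < α ^ (-(2 * sigmaExp μ 4)) := by positivity
    have ht2 := ht α 2
    have ht4 := ht α 4
    simp only [hdiv hα, ← Finset.mul_sum, hs5, zero_sub, mul_neg, neg_mul, ← ht] at hA hB
    rw [hsum4] at hA
    exact ⟨by rw [ht2]; positivity, ht4 ▸ mul_neg_of_neg_of_pos h4' hp4,
      pos_of_mul_pos_right hA hα.le, by linarith⟩
  · refine main α hα (Or.inr (Or.inl ?_))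
    have hp2 : 0 < α ^ (-(2 * sigmaExp μ 2)) := by positivity
    have hp4 : 0 < α ^ (-(2 * sigmaExp μ 4)) := by positivity
    have ht2 := ht α 2
    have ht4 := ht α 4
    simp only [hdiv hα, ← Finset.mul_sum, hs5, zero_sub, mul_neg, ← ht] at hA hB
    have hA' := pos_of_mul_pos_right hA hα.le
    norm_num at hA' hB
    exact ⟨ht2 ▸ mul_neg_of_neg_of_pos h2 hp2, by rw [ht4]; positivity, hA', by linarith⟩
  · refine main α hα (Or.inr (Or.inr ?_))
    have hp2 : 0 < α ^ (-(2 * sigmaExp μ 2)) := by positivity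
    have hp4 : 0 < α ^ (-(2 * sigmaExp μ 4)) := by positivity
    have ht2 := ht α 2
    have ht4 := ht α 4
    simp only [hdiv hα, ← Finset.mul_sum, hs5, zero_sub, mul_neg, ← ht] at hA hB
    have hA' := pos_of_mul_pos_right hA hα.le
    norm_num at hA' hB
    exact ⟨ht2 ▸ mul_neg_of_neg_of_pos h2 hp2, ht4 ▸ mul_neg_of_neg_of_pos h4' hp4, by linarith,
      by linarith⟩

/-- The symbol is elliptic of order `2 - μ` with no zeros: positivity on bounded sets follows by
compactness, and near infinity the term with `C₁ > 0` dominates. -/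
theorem exists_le_sq_norm_opSymbol {p q a b μ : ℝ} (hb : b ≠ 0) (hpq : p ^ 2 + q ^ 2 ≠ 0)
    (hμ₀ : 0 < μ) (hμ₁ : μ < 1) (hcond : CoefCondition p q a b μ) :
    ∃ c : ℝ, 0 < c ∧ ∀ ξ, c * (1 + |2 * Real.pi * ξ| ^ (2 * (2 - μ))) ≤
      ‖opSymbol p q a b (2 - μ) ξ‖ ^ 2 := by
  set Q : ℝ → ℝ := fun r =>
    ∑ j ∈ ({1, 2, 3, 4, 5} : Finset ℕ), coefC p q a b μ j * r ^ (2 * sigmaExp μ j) with hQ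
  set s := 2 - μ with hs
  suffices h : ∃ c : ℝ, 0 < c ∧ ∀ r, 0 ≤ r → c * (1 + r ^ (2 * s)) ≤ Q r by
    obtain ⟨c, hc, h⟩ := h
    refine ⟨c, hc, fun ξ => ?_⟩
    rw [sq_norm_opSymbol p q a b (by linarith)]
    exact h _ (abs_nonneg _)
  have hσ : ∀ j, 0 ≤ 2 * sigmaExp μ j := by
    intro j
    unfold sigmaExp
    split <;> linarith
  have hQc : Continuous Q := by
    refine continuous_finsetSum _ fun j _ => continuous_const.mul ?_
    exact Real.continuous_rpow_const (hσ j)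
  have hQpos : ∀ r, 0 ≤ r → 0 < Q r := fun r hr =>
    sum_coefC_rpow_pos hb hpq hμ₀ hμ₁ hcond hr
  have hC1 := coefC_one_pos a b hpq hμ₀ hμ₁
  have hlim : Tendsto (fun r => Q r * r ^ (-(2 * s))) atTop (𝓝 (coefC p q a b μ 1)) := by
    have hterm : ∀ j ∈ ({1, 2, 3, 4, 5} : Finset ℕ), Tendsto
        (fun r : ℝ => coefC p q a b μ j * r ^ (-(2 * s - 2 * sigmaExp μ j))) atTop
        (𝓝 (if j = 1 then coefC p q a b μ 1 else 0)) := by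
      intro j hj
      by_cases h1 : j = 1
      · subst h1
        simp [sigmaExp, ← hs]
      · rw [if_neg h1, ← mul_zero (coefC p q a b μ j)]
        refine Tendsto.const_mul _ (tendsto_rpow_neg_atTop ?_)
        simp only [Finset.mem_insert, Finset.mem_singleton] at hj
        rcases hj with rfl | rfl | rfl | rfl | rfl <;> simp only [sigmaExp] <;>
          first | exact absurd rfl h1 | linarith
    have := tendsto_finsetSum _ hterm
    simp only [Finset.sum_ite_eq', Finset.mem_insert, true_or, if_true] at this
    refine this.congr' ?_
    filter_upwards [eventually_gt_atTop 0] with r hr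
    rw [hQ, Finset.sum_mul]
    refine Finset.sum_congr rfl fun j _ => ?_
    rw [mul_assoc, ← Real.rpow_add hr]
    congr 2
    ring
  -- Beyond `R` the normalised sum exceeds `C₁ / 2`, and `r ^ (2 * s) ≥ (1 + r ^ (2 * s)) / 2`,
  -- which is where the constant `C₁ / 4` comes from.
  obtain ⟨R, hR⟩ := (((tendsto_order.1 hlim).1 _ (half_lt_self hC1)).and
    (eventually_ge_atTop 1)).exists_forall_of_atTop
  have hden : ∀ r : ℝ, 0 ≤ r → 0 < 1 + r ^ (2 * s) := fun r hr => by positivity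
  obtain ⟨x, hx, hmin⟩ := (isCompact_Icc (a := (0 : ℝ)) (b := max R 0)).exists_isMinOn
    ⟨0, by simp⟩ (f := fun r => Q r / (1 + r ^ (2 * s)))
    (hQc.continuousOn.div
      (continuous_const.add (Real.continuous_rpow_const (by linarith))).continuousOn
      fun r hr => (hden r hr.1).ne')
  have hx0 : 0 < Q x / (1 + x ^ (2 * s)) := div_pos (hQpos x hx.1) (hden x hx.1)
  refine ⟨min (Q x / (1 + x ^ (2 * s))) (coefC p q a b μ 1 / 4),
    lt_min hx0 (by positivity), fun r hr => ?_⟩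
  rcases le_total r (max R 0) with h | h
  · refine (mul_le_mul_of_nonneg_right (min_le_left _ _) (hden r hr).le).trans ?_
    exact (le_div_iff₀ (hden r hr)).1 (hmin ⟨hr, h⟩)
  · refine (mul_le_mul_of_nonneg_right (min_le_right _ _) (hden r hr).le).trans ?_
    obtain ⟨h1, h2⟩ := hR r ((le_max_left _ _).trans h)
    have hp : 0 < r ^ (2 * s) := by positivity
    have h3 : 1 ≤ r ^ (2 * s) := Real.one_le_rpow h2 (by linarith)
    rw [Real.rpow_neg hr, ← div_eq_mul_inv, lt_div_iff₀ hp] at h1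
    nlinarith

/-! ### Sobolev norms, weak derivatives and the solution operator -/

lemma integrable_sq_norm_plancherel (w : L2R) : Integrable fun ξ => ‖plancherel w ξ‖ ^ 2 :=
  (memLp_two_iff_integrable_sq_norm (Lp.aestronglyMeasurable _)).1 (Lp.memLp _)

lemma sq_norm_eq_integral_plancherel (w : L2R) : ‖w‖ ^ 2 = ∫ ξ, ‖plancherel w ξ‖ ^ 2 := by
  rw [← norm_plancherel, ← real_inner_self_eq_norm_sq, L2.inner_def]
  simp

lemma memHhat_zero (w : L2R) : MemHhat 0 w := by
  have := (integrable_sq_norm_plancherel w).const_mul 2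
  refine this.congr (Eventually.of_forall fun ξ => ?_)
  norm_num

/-- The Sobolev norm as a single weighted `L²` norm on the Fourier side. -/
lemma normHhat_eq_sqrt_integral {s : ℝ} {w : L2R} (hw : MemHhat s w) :
    normHhat s w =
      Real.sqrt (∫ ξ : ℝ, (1 + |2 * Real.pi * ξ| ^ (2 * s)) * ‖plancherel w ξ‖ ^ 2) := by
  have h2 : Integrable fun ξ : ℝ => |2 * Real.pi * ξ| ^ (2 * s) * ‖plancherel w ξ‖ ^ 2 := by
    refine (hw.sub (integrable_sq_norm_plancherel w)).congr (Eventually.of_forall fun ξ => ?_)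
    simp only [Pi.sub_apply]
    ring
  have e : ∀ ξ : ℝ, (|2 * Real.pi * ξ| ^ s * ‖plancherel w ξ‖) ^ 2 =
      |2 * Real.pi * ξ| ^ (2 * s) * ‖plancherel w ξ‖ ^ 2 := fun ξ => by
    rw [mul_pow, mul_comm 2 s, Real.rpow_mul (abs_nonneg _), Real.rpow_two]
  rw [normHhat, seminormHhat, Real.sq_sqrt (integral_nonneg fun ξ => by positivity),
    sq_norm_eq_integral_plancherel]
  simp only [e]
  rw [← integral_add (integrable_sq_norm_plancherel w) h2]
  congr 2
  ext ξ
  ring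

lemma ofReal_compLp_add (v w : L2R) :
    (ofRealCLM.compLp (v + w) : Lp ℂ 2 (volume : Measure ℝ)) =
      ofRealCLM.compLp v + ofRealCLM.compLp w :=
  (ofRealCLM.compLpL 2 volume).map_add v w

lemma plancherel_add (v w : L2R) : plancherel (v + w) = plancherel v + plancherel w := by
  rw [plancherel, ofReal_compLp_add, FourierTransform.fourier_add]
  rfl

lemma plancherel_smul (c : ℝ) (w : L2R) : plancherel (c • w) = (c : ℂ) • plancherel w := by
  have : (ofRealCLM.compLp (c • w) : Lp ℂ 2 (volume : Measure ℝ)) =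
      (c : ℂ) • ofRealCLM.compLp w := by
    refine Lp.ext ?_
    filter_upwards [coeFn_ofReal_compLp (c • w), coeFn_ofReal_compLp w, Lp.coeFn_smul c w,
      Lp.coeFn_smul (c : ℂ) (ofRealCLM.compLp w : Lp ℂ 2 (volume : Measure ℝ))] with x h1 h2 h3 h4
    rw [h1, h4, Pi.smul_apply, h2, h3]
    simp
  rw [plancherel, this, FourierTransform.fourier_smul]
  rfl

/-- A Hermitian multiplier of order at most `s` acts on the Sobolev space of order `s`, with values
in the real-valued square integrable functions. -/
lemma exists_plancherel_eq_mul {s : ℝ} {u : L2R} (hu : MemHhat s u) {m : ℝ → ℂ}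
    (hm : Measurable m) {K : ℝ} (hK : ∀ ξ, ‖m ξ‖ ^ 2 ≤ K * (1 + |2 * Real.pi * ξ| ^ (2 * s)))
    (hh : ∀ ξ, m (-ξ) = (starRingEnd ℂ) (m ξ)) :
    ∃ w : L2R, ∀ᵐ ξ, plancherel w ξ = m ξ * plancherel u ξ := by
  have hmeas : AEStronglyMeasurable (fun ξ => m ξ * plancherel u ξ) :=
    hm.aestronglyMeasurable.mul (Lp.aestronglyMeasurable _)
  refine exists_plancherel_eq ((memLp_two_iff_integrable_sq_norm hmeas).2 ?_) ?_
  · refine (Integrable.const_mul hu K).mono' (hmeas.norm.pow 2) (Eventually.of_forall fun ξ => ?_)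
    rw [Real.norm_of_nonneg (by positivity), norm_mul, mul_pow, ← mul_assoc]
    exact mul_le_mul_of_nonneg_right (hK ξ) (by positivity)
  · filter_upwards [plancherel_neg u] with ξ hξ
    rw [hξ, hh, map_mul]

lemma sq_norm_fracSymbol (s ξ : ℝ) : ‖fracSymbol s ξ‖ ^ 2 = |2 * Real.pi * ξ| ^ (2 * s) := by
  rw [norm_fracSymbol, mul_comm 2 s, Real.rpow_mul (abs_nonneg _), Real.rpow_two]

lemma isWeakFracDeriv_of_plancherel {s : ℝ} (hs1 : 1 < s) (hs2 : s < 2) {u w : L2R}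
    (h : ∀ᵐ ξ, plancherel w ξ = fracSymbol s ξ * plancherel u ξ) : IsWeakFracDeriv s u w := by
  refine ⟨locallyIntegrable_lp u, locallyIntegrable_lp w, fun ψ hψ => ?_⟩
  refine integral_mul_eq_of_multiplier hψ (rlDerivStar_eq_fourierInv hs1 hs2 hψ)
    (memLp_one_iff_integrable.1 (memLp_neg_fracSymbol_mul (by linarith) hs2.le hψ 1))
    (memLp_neg_fracSymbol_mul (by linarith) hs2.le hψ 2) ?_
  filter_upwards [h] with ξ hξ
  rw [hξ, fracSymbol_neg, conj_conj]

lemma isWeakFracDerivStar_of_plancherel {s : ℝ} (hs1 : 1 < s) (hs2 : s < 2) {u w : L2R}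
    (h : ∀ᵐ ξ, plancherel w ξ = fracSymbol s (-ξ) * plancherel u ξ) :
    IsWeakFracDerivStar s u w := by
  refine ⟨locallyIntegrable_lp u, locallyIntegrable_lp w, fun ψ hψ => ?_⟩
  refine integral_mul_eq_of_multiplier hψ (rlDeriv_eq_fourierInv hs1 hs2 hψ)
    (memLp_one_iff_integrable.1 (memLp_fracSymbol_mul (by linarith) hs2.le hψ 1))
    (memLp_fracSymbol_mul (by linarith) hs2.le hψ 2) ?_
  filter_upwards [h] with ξ hξ
  rw [hξ, fracSymbol_neg]

lemma fracSymbol_one_neg (ξ : ℝ) : fracSymbol 1 (-ξ) = -fracSymbol 1 ξ := by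
  simp [fracSymbol]

lemma isWeakDeriv_of_plancherel {u w : L2R}
    (h : ∀ᵐ ξ, plancherel w ξ = fracSymbol 1 ξ * plancherel u ξ) : IsWeakDeriv u w := by
  refine ⟨locallyIntegrable_lp u, locallyIntegrable_lp w, fun ψ hψ => ?_⟩
  -- The adjoint of the first derivative is `-D`, so the multiplier lemma is applied to `-ψ'`.
  have hD (x : ℝ) : ((-deriv ψ x : ℝ) : ℂ) =
      𝓕⁻ (fun ξ => fracSymbol 1 (-ξ) * 𝓕 (fun x => (ψ x : ℂ)) ξ) x := by
    rw [ofReal_neg, hψ.deriv_eq_fourierInv, Real.fourierInv_eq', Real.fourierInv_eq',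
      ← integral_neg]
    simp [fracSymbol_one_neg]
  have := (integral_mul_eq_of_multiplier hψ hD
    (memLp_one_iff_integrable.1 (memLp_neg_fracSymbol_mul zero_le_one one_le_two hψ 1))
    (memLp_neg_fracSymbol_mul zero_le_one one_le_two hψ 2) (u := u) (v := w) (by
      filter_upwards [h] with ξ hξ
      rw [hξ, fracSymbol_neg, conj_conj])).2
  rw [← this, ← integral_neg]
  simp

lemma ae_eq_of_integral_testFn_eq {v w : ℝ → ℝ} (hv : LocallyIntegrable v)
    (hw : LocallyIntegrable w) (h : ∀ ψ, IsTestFn ψ → ∫ x, v x * ψ x = ∫ x, w x * ψ x) :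
    v =ᵐ[volume] w :=
  ae_eq_of_integral_contDiff_smul_eq hv hw fun ψ h1 h2 => by
    simpa [mul_comm] using h ψ ⟨h1, h2⟩

lemma IsWeakFracDeriv.ae_eq {s : ℝ} {u v w : ℝ → ℝ} (hv : IsWeakFracDeriv s u v)
    (hw : IsWeakFracDeriv s u w) : v =ᵐ[volume] w :=
  ae_eq_of_integral_testFn_eq hv.2.1 hw.2.1 fun ψ hψ =>
    (hv.2.2 ψ hψ).2.symm.trans (hw.2.2 ψ hψ).2

lemma IsWeakFracDerivStar.ae_eq {s : ℝ} {u v w : ℝ → ℝ} (hv : IsWeakFracDerivStar s u v)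
    (hw : IsWeakFracDerivStar s u w) : v =ᵐ[volume] w :=
  ae_eq_of_integral_testFn_eq hv.2.1 hw.2.1 fun ψ hψ =>
    (hv.2.2 ψ hψ).2.symm.trans (hw.2.2 ψ hψ).2

lemma IsWeakDeriv.ae_eq {u v w : ℝ → ℝ} (hv : IsWeakDeriv u v)
    (hw : IsWeakDeriv u w) : v =ᵐ[volume] w :=
  ae_eq_of_integral_testFn_eq hv.2.1 hw.2.1 fun ψ hψ =>
    neg_injective ((hv.2.2 ψ hψ).symm.trans (hw.2.2 ψ hψ))

/-- On the Fourier side the equation is the multiplication by its symbol. -/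
theorem isSolution_iff_plancherel {p q a b μ : ℝ} (hμ₀ : 0 < μ) (hμ₁ : μ < 1) {f u : L2R} :
    IsSolution p q a b μ f u ↔ MemHhat (2 - μ) u ∧
      ∀ᵐ ξ, opSymbol p q a b (2 - μ) ξ * plancherel u ξ = plancherel f ξ := by
  rw [IsSolution, and_congr_right_iff]
  intro hu
  set s := 2 - μ with hs
  have hs1 : 1 < s := by linarith
  have hs2 : s < 2 := by linarith
  obtain ⟨w₁, h₁⟩ := exists_plancherel_eq_mul hu (measurable_fracSymbol s) (K := 1)
    (fun ξ => by rw [sq_norm_fracSymbol]; linarith) (fracSymbol_neg s)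
  obtain ⟨w₂, h₂⟩ := exists_plancherel_eq_mul hu
    ((measurable_fracSymbol s).comp measurable_neg) (K := 1)
    (fun ξ => by
      rw [Function.comp_apply, fracSymbol_neg, RCLike.norm_conj, sq_norm_fracSymbol]; linarith)
    (fun ξ => fracSymbol_neg s (-ξ))
  obtain ⟨w₃, h₃⟩ := exists_plancherel_eq_mul hu (measurable_fracSymbol 1) (K := 1)
    (fun ξ => by
      rw [sq_norm_fracSymbol]
      have h0 : 0 ≤ |2 * Real.pi * ξ| ^ (2 * s) := by positivity
      rcases le_total |2 * Real.pi * ξ| 1 with h | h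
      · have := Real.rpow_le_one (abs_nonneg _) h (by norm_num : (0 : ℝ) ≤ 2 * 1)
        linarith
      · have := Real.rpow_le_rpow_of_exponent_le h (by linarith : (2 : ℝ) * 1 ≤ 2 * s)
        linarith) (fracSymbol_neg 1)
  have d₁ := isWeakFracDeriv_of_plancherel hs1 hs2 h₁
  have d₂ := isWeakFracDerivStar_of_plancherel hs1 hs2 h₂
  have d₃ := isWeakDeriv_of_plancherel h₃
  set S : L2R := p • w₁ + q • w₂ + a • w₃ + b • u with hS
  have hSx : ∀ᵐ x, S x = p * w₁ x + q * w₂ x + a * w₃ x + b * u x := by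
    filter_upwards [Lp.coeFn_add (p • w₁ + q • w₂ + a • w₃) (b • u),
      Lp.coeFn_add (p • w₁ + q • w₂) (a • w₃), Lp.coeFn_add (p • w₁) (q • w₂),
      Lp.coeFn_smul p w₁, Lp.coeFn_smul q w₂, Lp.coeFn_smul a w₃, Lp.coeFn_smul b u]
      with x e1 e2 e3 e4 e5 e6 e7
    rw [hS, e1, Pi.add_apply, e2, Pi.add_apply, e3, Pi.add_apply, e4, e5, e6, e7]
    rfl
  have hSξ : ∀ᵐ ξ, plancherel S ξ = opSymbol p q a b s ξ * plancherel u ξ := by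
    rw [hS, plancherel_add, plancherel_add, plancherel_add, plancherel_smul, plancherel_smul,
      plancherel_smul, plancherel_smul]
    filter_upwards [h₁, h₂, h₃, Lp.coeFn_add ((p : ℂ) • plancherel w₁ + (q : ℂ) • plancherel w₂ +
        (a : ℂ) • plancherel w₃) ((b : ℂ) • plancherel u),
      Lp.coeFn_add ((p : ℂ) • plancherel w₁ + (q : ℂ) • plancherel w₂) ((a : ℂ) • plancherel w₃),
      Lp.coeFn_add ((p : ℂ) • plancherel w₁) ((q : ℂ) • plancherel w₂),
      Lp.coeFn_smul (p : ℂ) (plancherel w₁), Lp.coeFn_smul (q : ℂ) (plancherel w₂),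
      Lp.coeFn_smul (a : ℂ) (plancherel w₃), Lp.coeFn_smul (b : ℂ) (plancherel u)]
      with ξ g1 g2 g3 e1 e2 e3 e4 e5 e6 e7
    rw [e1, Pi.add_apply, e2, Pi.add_apply, e3, Pi.add_apply, e4, e5, e6, e7]
    simp only [Pi.smul_apply, smul_eq_mul, g1, g2, g3, Function.comp_apply, opSymbol]
    ring
  constructor
  · rintro ⟨v₁, v₂, v₃, k₁, k₂, k₃, heq⟩
    have hSf : S = f := by
      refine Lp.ext ?_
      filter_upwards [hSx, heq, d₁.ae_eq k₁, d₂.ae_eq k₂, d₃.ae_eq k₃] with x e0 e1 e2 e3 e4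
      rw [e0, e2, e3, e4, e1]
    rw [← hSf]
    filter_upwards [hSξ] with ξ hξ using hξ.symm
  · intro h
    refine ⟨w₁, w₂, w₃, d₁, d₂, d₃, ?_⟩
    have hSf : S = f := by
      refine plancherel_injective (Lp.ext ?_)
      filter_upwards [hSξ, h] with ξ e1 e2
      rw [e1, e2]
    rw [← hSf]
    filter_upwards [hSx] with x hx using hx.symm

/-- The pointwise form of the gain of `s` derivatives, with a constant independent of `t`. -/
lemma one_add_rpow_mul_sq_le {x s t c F U P : ℝ} (hx : 0 ≤ x) (hs : 0 < s) (ht : 0 ≤ t)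
    (hc : 0 < c) (hP : c * (1 + x ^ (2 * s)) ≤ P ^ 2) (hPU : P * U = F) :
    (1 + x ^ (2 * (s + t))) * U ^ 2 ≤ c⁻¹ * ((1 + x ^ (2 * t)) * F ^ 2) := by
  have h1 : x ^ (2 * (s + t)) = x ^ (2 * s) * x ^ (2 * t) := by
    rw [mul_add, Real.rpow_add_of_nonneg hx (by linarith) (by linarith)]
  have p1 : 0 ≤ x ^ (2 * s) := by positivity
  have p2 : 0 ≤ x ^ (2 * t) := by positivity
  rw [h1, ← hPU, mul_pow, ← div_eq_inv_mul, le_div_iff₀ hc]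
  calc (1 + x ^ (2 * s) * x ^ (2 * t)) * U ^ 2 * c
      ≤ ((1 + x ^ (2 * s)) * (1 + x ^ (2 * t))) * U ^ 2 * c := by
        gcongr
        nlinarith
    _ = (c * (1 + x ^ (2 * s))) * ((1 + x ^ (2 * t)) * U ^ 2) := by ring
    _ ≤ P ^ 2 * ((1 + x ^ (2 * t)) * U ^ 2) := by gcongr
    _ = (1 + x ^ (2 * t)) * (P ^ 2 * U ^ 2) := by ring

/-- Elliptic regularity: dividing by the symbol gains `s` derivatives. -/
lemma memHhat_add_and_normHhat_le {s t c : ℝ} (hs : 0 < s) (ht : 0 ≤ t) (hc : 0 < c) {P : ℝ → ℂ}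
    (hP : ∀ ξ, c * (1 + |2 * Real.pi * ξ| ^ (2 * s)) ≤ ‖P ξ‖ ^ 2) {f u : L2R}
    (hf : MemHhat t f) (hu : ∀ᵐ ξ, P ξ * plancherel u ξ = plancherel f ξ) :
    MemHhat (s + t) u ∧ normHhat (s + t) u ≤ Real.sqrt c⁻¹ * normHhat t f := by
  have hle : ∀ᵐ ξ : ℝ, (1 + |2 * Real.pi * ξ| ^ (2 * (s + t))) * ‖plancherel u ξ‖ ^ 2 ≤
      c⁻¹ * ((1 + |2 * Real.pi * ξ| ^ (2 * t)) * ‖plancherel f ξ‖ ^ 2) := by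
    filter_upwards [hu] with ξ hξ
    exact one_add_rpow_mul_sq_le (abs_nonneg _) hs ht hc (hP ξ) (by rw [← norm_mul, hξ])
  have hfi := Integrable.const_mul hf c⁻¹
  have hmem : MemHhat (s + t) u := by
    refine hfi.mono' ?_ ?_
    · have : Measurable fun ξ : ℝ => 1 + |2 * Real.pi * ξ| ^ (2 * (s + t)) := by fun_prop
      exact this.aestronglyMeasurable.mul ((Lp.aestronglyMeasurable (plancherel u)).norm.pow 2)
    · filter_upwards [hle] with ξ hξ
      rwa [Real.norm_of_nonneg (by positivity)]
  refine ⟨hmem, ?_⟩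
  rw [normHhat_eq_sqrt_integral hmem, normHhat_eq_sqrt_integral hf,
    ← Real.sqrt_mul (by positivity), ← integral_const_mul]
  exact Real.sqrt_le_sqrt (integral_mono_ae hmem hfi hle)

theorem mainTheorem3 (p q a b μ : ℝ) (hb : b ≠ 0) (hpq : p ^ 2 + q ^ 2 ≠ 0)
    (hμ₀ : 0 < μ) (hμ₁ : μ < 1) (hcond : CoefCondition p q a b μ) :
    ∃ C : ℝ, 0 < C ∧ ∀ (m : ℕ) (f : L2R), MemHhat (m : ℝ) f →
      ∃ u : L2R, IsSolution p q a b μ f u ∧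
        (∀ v : L2R, IsSolution p q a b μ f v → v = u) ∧
        MemHhat (2 - μ + m) u ∧
        normHhat (2 - μ + m) u ≤ C * normHhat (m : ℝ) f := by
  obtain ⟨c, hc, hP⟩ := exists_le_sq_norm_opSymbol hb hpq hμ₀ hμ₁ hcond
  have hs : 0 < 2 - μ := by linarith
  have hP0 (ξ : ℝ) : opSymbol p q a b (2 - μ) ξ ≠ 0 := by
    intro h
    have h1 := hP ξ
    rw [h, norm_zero] at h1
    have : 0 < c * (1 + |2 * Real.pi * ξ| ^ (2 * (2 - μ))) := by positivity
    linarith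
  refine ⟨Real.sqrt c⁻¹, by positivity, fun m f hf => ?_⟩
  obtain ⟨u, hu⟩ := exists_plancherel_eq_mul (memHhat_zero f)
    (measurable_opSymbol p q a b (2 - μ)).inv (K := c⁻¹) (fun ξ => by
      have h0 : 0 ≤ |2 * Real.pi * ξ| ^ (2 * (2 - μ)) := by positivity
      have h1 : c ≤ ‖opSymbol p q a b (2 - μ) ξ‖ ^ 2 := by nlinarith [hP ξ]
      have h2 : (‖opSymbol p q a b (2 - μ) ξ‖ ^ 2)⁻¹ ≤ c⁻¹ := inv_anti₀ hc h1
      have h3 : 0 < c⁻¹ := by positivity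
      rw [Pi.inv_apply, norm_inv, inv_pow, mul_zero, Real.rpow_zero]
      linarith)
    (fun ξ => by rw [Pi.inv_apply, Pi.inv_apply, opSymbol_neg, map_inv₀])
  have hu' : ∀ᵐ ξ, opSymbol p q a b (2 - μ) ξ * plancherel u ξ = plancherel f ξ := by
    filter_upwards [hu] with ξ hξ
    rw [hξ, Pi.inv_apply, mul_inv_cancel_left₀ (hP0 ξ)]
  have hmem : MemHhat (2 - μ) u := by
    have := (memHhat_add_and_normHhat_le hs le_rfl hc hP (memHhat_zero f) hu').1
    rwa [add_zero] at this
  refine ⟨u, (isSolution_iff_plancherel hμ₀ hμ₁).2 ⟨hmem, hu'⟩, fun v hv => ?_,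
    memHhat_add_and_normHhat_le hs m.cast_nonneg hc hP hf hu'⟩
  refine plancherel_injective (Lp.ext ?_)
  filter_upwards [hu', ((isSolution_iff_plancherel hμ₀ hμ₁).1 hv).2] with ξ h1 h2
  exact mul_left_cancel₀ (hP0 ξ) (h2.trans h1.symm)
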